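/- Let $n\ge 1$, $\alpha\in(0,1)$, and let $\Omega\subset\mathbb{R}^n$ be a (possibly unbounded) domain, i.e. a nonempty connected open set, with boundary of class $C^n_{loc}$, and of class $C^{2,\alpha}_{loc}$ if $n=2$. Consider $$\mathcal{L}u=-\nabla\cdot(A\nabla u)-B\cdot\nabla u-cu\quad\text{in }\Omega,$$ where $A\in C^{1,\alpha}_{loc}\cap L^\infty(\overline\Omega)$ is matrix-valued and $A(x)$ is symmetric positive definite for every $x\in\Omega$ (not necessarily uniformly in $x$), and $B,c\in C^{0,\alpha}_{loc}\cap L^\infty(\overline\Omega)$ are $\mathbb{R}^n$-valued and real-valued respectively. Let the boundary operator be either $\mathcal{B}u=u$ (Dirichlet) or $\mathcal{B}u=\nu\cdot A\nabla u+\gamma u$ (Robin) on $\partial\Omega$, where $\nu$ is the outer unit normal and $\gamma\in C^{1,\alpha}_{loc}\cap L^\infty(\partial\Omega)$ has no prescribed sign. Let $$\lambda_1:=\sup\{\lambda\in\mathbb{R}:\ \exists\, u\in C^{2,\alpha}_{loc}(\overline\Omega),\ u>0\text{ in }\Omega,\ \mathcal{L}u-\lambda u\ge 0\text{ in }\Omega,\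 \mathcal{B}u\ge 0\text{ on }\partial\Omega\}\in[-\infty,+\infty]$$ be the generalized principal eigenvalue. A principal eigenfunction is a function $\varphi\in C^{2,\alpha}_{loc}(\overline\Omega)$ with $\varphi>0$ in $\Omega$, $\mathcal{L}\varphi=\lambda_1\varphi$ in $\Omega$ and $\mathcal{B}\varphi=0$ on $\partial\Omega$ (in particular, $\lambda_1$ is finite if one exists). Assume that there is $\eta\in C^1(\Omega)\cap L^\infty(\Omega)$ with $\nabla\eta=-A^{-1}B$ in $\Omega$, that $|\Omega\cap\{|x|\le R\}|=O(R^2)$ as $R\to+\infty$, and that there exists a bounded principal eigenfunction. Then $\lambda_1$ is simple: for any two principal eigenfunctions $\varphi,\psi$ there is a constant $t\in\mathbb{R}$ such that $\psi=t\varphi$ on $\overline\Omega$. -/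

import Mathlib

open Set Filter Topology MeasureTheory
open scoped NNReal Matrix

noncomputable section

namespace EllipticBVP

/-- The Euclidean space `ℝⁿ`. -/
abbrev E (n : ℕ) : Type := EuclideanSpace ℝ (Fin n)

/-- The class `C^{k,α}_loc(s)`: `u` is `k` times continuously differentiable on `s` (up to the
boundary points that belong to `s`), and its derivative of order `k` is `α`-Hölder on every
compact subset of `s`. It is used with `s` open and with `s` the closure of a regular domain;
in both cases the derivatives within `s` are unique. -/
def HolderLoc {n : ℕ} (k : ℕ) (α : ℝ≥0) (s : Set (E n)) (u : E n → ℝ) : Prop :=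
  ContDiffOn ℝ k u s ∧
    ∀ K ⊆ s, IsCompact K → ∃ C : ℝ≥0, HolderOnWith C α (iteratedFDerivWithin ℝ k u s) K

/-- `f` is bounded on `s`. -/
def BoundedOn {n : ℕ} (s : Set (E n)) (f : E n → ℝ) : Prop :=
  ∃ M : ℝ, ∀ x ∈ s, |f x| ≤ M

/-- The boundary of `Ω ⊆ ℝⁿ` is of class `C^n_loc`, and of class `C^{2,α}_loc` if `n = 2`: near
each of its boundary points, `Ω` is the sublevel set `{ρ < 0}` of a function `ρ` of that class
with nonvanishing differential (equivalently, by the implicit function theorem, `Ω` is locally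
the region on one side of the graph of a function of that class). -/
def HasRegularBoundary {n : ℕ} (α : ℝ≥0) (Ω : Set (E n)) : Prop :=
  ∀ p ∈ frontier Ω, ∃ (U : Set (E n)) (ρ : E n → ℝ), IsOpen U ∧ p ∈ U ∧
    ContDiffOn ℝ n ρ U ∧ (n = 2 → HolderLoc 2 α U ρ) ∧
    (∀ x ∈ U, fderiv ℝ ρ x ≠ 0) ∧ Ω ∩ U = {x ∈ U | ρ x < 0}

/-- `ν` is an outer unit normal vector of `Ω` at `p`: directions that make an obtuse angle with
`ν` enter `Ω`, and directions that make an acute angle with `ν` do not. -/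
def IsOuterUnitNormal {n : ℕ} (Ω : Set (E n)) (p ν : E n) : Prop :=
  ‖ν‖ = 1 ∧ (∀ v : E n, inner ℝ ν v < 0 → ∀ᶠ t : ℝ in 𝓝[>] 0, p + t • v ∈ Ω) ∧
    (∀ v : E n, 0 < inner ℝ ν v → ∀ᶠ t : ℝ in 𝓝[>] 0, p + t • v ∉ Ω)

/-- The outer unit normal `ν(p)` of `Ω` at `p`. -/
def outerNormal {n : ℕ} (Ω : Set (E n)) (p : E n) : E n :=
  Classical.epsilon (IsOuterUnitNormal Ω p)

theorem IsOuterUnitNormal.unique {n : ℕ} {Ω : Set (E n)} {p ν μ : E n}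
    (hν : IsOuterUnitNormal Ω p ν) (hμ : IsOuterUnitNormal Ω p μ) : ν = μ := by
  by_contra hne
  have hlt : inner ℝ ν μ < 1 := by
    refine lt_of_le_of_ne ?_ ?_
    · simpa [hν.1, hμ.1] using real_inner_le_norm ν μ
    · intro h
      exact hne ((inner_eq_one_iff_of_norm_eq_one hν.1 hμ.1).1 h)
  have h1 : inner ℝ ν (μ - ν) < 0 := by
    rw [inner_sub_right, real_inner_self_eq_norm_sq, hν.1]; linarith
  have h2 : 0 < inner ℝ μ (μ - ν) := by
    rw [inner_sub_right, real_inner_self_eq_norm_sq, hμ.1, real_inner_comm]; linarith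
  obtain ⟨t, ht1, ht2⟩ := ((hν.2.1 _ h1).and (hμ.2.2 _ h2)).exists
  exact ht2 ht1

theorem outerNormal_eq {n : ℕ} {Ω : Set (E n)} {p ν : E n}
    (hν : IsOuterUnitNormal Ω p ν) : outerNormal Ω p = ν :=
  (Classical.epsilon_spec (p := IsOuterUnitNormal Ω p) ⟨ν, hν⟩).unique hν

/-- The outer unit normal is the normalized gradient of any local defining function. -/
theorem outerNormal_eq_gradient {n : ℕ} {Ω U : Set (E n)} {p : E n} {ρ : E n → ℝ}
    (hp : p ∈ frontier Ω) (hΩ : IsOpen Ω) (hU : IsOpen U) (hpU : p ∈ U)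
    (hρ : DifferentiableAt ℝ ρ p) (h0 : fderiv ℝ ρ p ≠ 0) (hΩU : Ω ∩ U = {x ∈ U | ρ x < 0}) :
    IsOuterUnitNormal Ω p (‖gradient ρ p‖⁻¹ • gradient ρ p) ∧
      outerNormal Ω p = ‖gradient ρ p‖⁻¹ • gradient ρ p := by
  have hg : gradient ρ p ≠ 0 := by
    simpa [gradient] using h0
  have hgn : 0 < ‖gradient ρ p‖ := norm_pos_iff.2 hg
  have hpΩ : p ∉ Ω := by
    rw [hΩ.frontier_eq] at hp; exact hp.2
  have hmem : ∀ x ∈ U, (x ∈ Ω ↔ ρ x < 0) := fun x hx => by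
    have := Set.ext_iff.1 hΩU x
    simpa [hx] using this
  have hρp : ρ p = 0 := by
    refine le_antisymm ?_ (not_lt.1 fun h => hpΩ ((hmem p hpU).2 h))
    by_contra hpos
    have hevU : ∀ᶠ x in 𝓝 p, x ∈ U := hU.mem_nhds hpU
    have hev : ∀ᶠ x in 𝓝 p, x ∈ U ∧ 0 < ρ x :=
      hevU.and (hρ.continuousAt.eventually (lt_mem_nhds (not_le.1 hpos)))
    obtain ⟨x, hx, hxΩ⟩ := mem_closure_iff_nhds.1 (frontier_subset_closure hp) _ hev
    exact absurd ((hmem x hx.1).1 hxΩ) (not_lt.2 hx.2.le)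
  have hline : ∀ v : E n, ∀ᶠ t : ℝ in 𝓝[>] 0, p + t • v ∈ U := fun v => by
    have hc : Tendsto (fun t : ℝ => p + t • v) (𝓝 0) (𝓝 p) := by
      have : Continuous (fun t : ℝ => p + t • v) := by fun_prop
      simpa using this.tendsto 0
    exact (hc.mono_left nhdsWithin_le_nhds).eventually (hU.mem_nhds hpU)
  have hslope : ∀ v : E n, Tendsto (fun t : ℝ => t⁻¹ * ρ (p + t • v)) (𝓝[>] 0)
      (𝓝 (inner ℝ (gradient ρ p) v)) := fun v => by
    have h := (hρ.hasFDerivAt.hasLineDerivAt v).tendsto_slope_zero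
    have hsub : Ioi (0 : ℝ) ⊆ {0}ᶜ := fun t ht => ne_of_gt ht
    have h' := h.mono_left (nhdsWithin_mono 0 hsub)
    have e : inner ℝ (gradient ρ p) v = fderiv ℝ ρ p v := by simp [gradient]
    rw [e]
    simpa [hρp] using h'
  have key : IsOuterUnitNormal Ω p (‖gradient ρ p‖⁻¹ • gradient ρ p) := by
    refine ⟨?_, fun v hv => ?_, fun v hv => ?_⟩
    · rw [norm_smul, norm_inv, norm_norm, inv_mul_cancel₀ hgn.ne']
    · rw [real_inner_smul_left] at hv
      have hv' : inner ℝ (gradient ρ p) v < 0 := by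
        by_contra h
        exact absurd hv (not_lt.2 (mul_nonneg (inv_nonneg.2 hgn.le) (not_lt.1 h)))
      filter_upwards [hline v, (hslope v).eventually (gt_mem_nhds hv'), self_mem_nhdsWithin]
        with t htU ht (htpos : 0 < t)
      refine (hmem _ htU).2 ?_
      by_contra h
      exact absurd ht (not_lt.2 (mul_nonneg (inv_nonneg.2 htpos.le) (not_lt.1 h)))
    · rw [real_inner_smul_left] at hv
      have hv' : 0 < inner ℝ (gradient ρ p) v := by
        by_contra h
        exact absurd hv (not_lt.2 (mul_nonpos_of_nonneg_of_nonpos (inv_nonneg.2 hgn.le)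
          (not_lt.1 h)))
      filter_upwards [hline v, (hslope v).eventually (lt_mem_nhds hv'), self_mem_nhdsWithin]
        with t htU ht (htpos : 0 < t) hmemΩ
      exact absurd ht (not_lt.2 (mul_nonpos_of_nonneg_of_nonpos (inv_nonneg.2 htpos.le)
        ((hmem _ htU).1 hmemΩ).le))
  exact ⟨key, outerNormal_eq key⟩

/-- Coefficients of the operator `ℒu = -∇·(A∇u) - B·∇u - cu`. Only their values on the closure
of the domain matter. -/
structure Coefficients (n : ℕ) where
  A : E n → Matrix (Fin n) (Fin n) ℝ
  B : E n → E n
  c : E n → ℝ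

/-- The action of a matrix on a vector of `ℝⁿ`. -/
def matVec {n : ℕ} (M : Matrix (Fin n) (Fin n) ℝ) (v : E n) : E n :=
  WithLp.toLp 2 (M *ᵥ WithLp.ofLp v)

/-- The divergence of a vector field. -/
def divergence {n : ℕ} (F : E n → E n) (x : E n) : ℝ :=
  ∑ i : Fin n, fderiv ℝ F x (EuclideanSpace.single i 1) i

/-- `ℒu(x) = -∇·(A∇u)(x) - B(x)·∇u(x) - c(x)u(x)`, for `x` in the open set `Ω`. -/
def Coefficients.op {n : ℕ} (L : Coefficients n) (u : E n → ℝ) (x : E n) : ℝ :=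
  -divergence (fun y => matVec (L.A y) (gradient u y)) x
    - inner ℝ (L.B x) (gradient u x) - L.c x * u x

/-- Boundary conditions: Dirichlet, or (indefinite) Robin with coefficient `γ`
(Neumann is `γ = 0`). -/
inductive BoundaryCondition (n : ℕ) where
  | dirichlet : BoundaryCondition n
  | robin (γ : E n → ℝ) : BoundaryCondition n

/-- The boundary operator: `ℬu = u`, or `ℬu = ν·A∇u + γu`, at a boundary point `x`. The gradient
at `x` is the one up to the boundary. -/
def BoundaryCondition.op {n : ℕ} (b : BoundaryCondition n) (Ω : Set (E n)) (L : Coefficients n)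
    (u : E n → ℝ) (x : E n) : ℝ :=
  match b with
  | .dirichlet => u x
  | .robin γ =>
      inner ℝ (outerNormal Ω x) (matVec (L.A x) (gradientWithin u (closure Ω) x)) + γ x * u x

/-- `γ ∈ C^{1,α}_loc ∩ L^∞(∂Ω)` in the Robin case; no condition in the Dirichlet case. Being
`C^{1,α}_loc` on the hypersurface `∂Ω` is being locally the restriction of a `C^{1,α}_loc`
function of `n` variables. -/
def BoundaryCondition.Regular {n : ℕ} (b : BoundaryCondition n) (α : ℝ≥0) (Ω : Set (E n)) :
    Prop :=
  match b with
  | .dirichlet => True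
  | .robin γ => BoundedOn (frontier Ω) γ ∧
      ∀ p ∈ frontier Ω, ∃ (U : Set (E n)) (γ' : E n → ℝ), IsOpen U ∧ p ∈ U ∧
        HolderLoc 1 α U γ' ∧ ∀ x ∈ U ∩ frontier Ω, γ' x = γ x

/-- The standing assumptions on the domain `Ω`, the operator `ℒ` and the boundary condition. -/
structure StandingAssumptions {n : ℕ} (α : ℝ≥0) (Ω : Set (E n)) (L : Coefficients n)
    (b : BoundaryCondition n) : Prop where
  isOpen : IsOpen Ω
  isConnected : IsConnected Ω
  regularBoundary : HasRegularBoundary α Ω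
  holder_A : ∀ i j, HolderLoc 1 α (closure Ω) (fun x => L.A x i j)
  bounded_A : ∀ i j, BoundedOn (closure Ω) (fun x => L.A x i j)
  holder_B : ∀ i, HolderLoc 0 α (closure Ω) (fun x => L.B x i)
  bounded_B : ∀ i, BoundedOn (closure Ω) (fun x => L.B x i)
  holder_c : HolderLoc 0 α (closure Ω) L.c
  bounded_c : BoundedOn (closure Ω) L.c
  elliptic : ∀ x ∈ Ω, (L.A x).PosDef
  boundary : b.Regular α Ω

/-- The drift derives from a bounded potential: there is `η ∈ C¹ ∩ L^∞(Ω)` with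
`∇η = -A⁻¹B` in `Ω`. -/
def BoundedPotentialDrift {n : ℕ} (Ω : Set (E n)) (L : Coefficients n) : Prop :=
  ∃ η : E n → ℝ, ContDiffOn ℝ 1 η Ω ∧ BoundedOn Ω η ∧
    ∀ x ∈ Ω, gradient η x = -matVec (L.A x)⁻¹ (L.B x)

/-- `|Ω ∩ {|x| ≤ R}| = O(R²)` as `R → +∞`. -/
def QuadraticGrowth {n : ℕ} (Ω : Set (E n)) : Prop :=
  (fun R : ℝ => (volume (Ω ∩ Metric.closedBall 0 R)).toReal) =O[atTop] (fun R : ℝ => R ^ 2)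

/-- `u ∈ C^{2,α}_loc(closure Ω)` is a positive supersolution of `(ℒ - l, ℬ)` in `Ω`. -/
structure IsPositiveSupersolution {n : ℕ} (α : ℝ≥0) (Ω : Set (E n)) (L : Coefficients n)
    (b : BoundaryCondition n) (l : ℝ) (u : E n → ℝ) : Prop where
  regular : HolderLoc 2 α (closure Ω) u
  pos : ∀ x ∈ Ω, 0 < u x
  interior : ∀ x ∈ Ω, 0 ≤ L.op u x - l * u x
  boundary : ∀ x ∈ frontier Ω, 0 ≤ b.op Ω L u x

/-- The generalized principal eigenvalue `λ₁`, the supremum (in the extended reals) of the reals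
`l` such that `(ℒ - l, ℬ)` admits a positive supersolution. -/
def principalEigenvalue {n : ℕ} (α : ℝ≥0) (Ω : Set (E n)) (L : Coefficients n)
    (b : BoundaryCondition n) : EReal :=
  sSup {l : EReal | ∃ r : ℝ, l = (r : EReal) ∧ ∃ u, IsPositiveSupersolution α Ω L b r u}

/-- `φ ∈ C^{2,α}_loc(closure Ω)` is a principal eigenfunction: `φ > 0` in `Ω`, `ℒφ = λ₁φ` in `Ω`
(so that in particular `λ₁` is finite) and `ℬφ = 0` on `∂Ω`. -/
structure IsPrincipalEigenfunction {n : ℕ} (α : ℝ≥0) (Ω : Set (E n)) (L : Coefficients n)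
    (b : BoundaryCondition n) (φ : E n → ℝ) : Prop where
  regular : HolderLoc 2 α (closure Ω) φ
  pos : ∀ x ∈ Ω, 0 < φ x
  interior : ∃ l : ℝ, principalEigenvalue α Ω L b = (l : EReal) ∧ ∀ x ∈ Ω, L.op φ x = l * φ x
  boundary : ∀ x ∈ frontier Ω, b.op Ω L φ x = 0

end EllipticBVP

end

open scoped Manifold

noncomputable section

namespace EllipticBVP

/-! Let φ be a bounded principal eigenfunction and ψ any other one. Since ∇η = -A⁻¹B, the weight
e^{-η} makes the operator self-adjoint, so F = e^{-η}(ψA∇φ - φA∇ψ) is divergence-free in Ω. Put a =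
ψ∇φ - φ∇ψ and σ = φ/(φ+ψ), which unlike φ/ψ is always bounded. Then F = e^{-η}Aa and ∇σ = a/(φ+ψ)²,
so D := F·∇σ = e^{-η} a·Aa/(φ+ψ)² is nonnegative and vanishes exactly where ∇σ does. It suffices to
show D = 0, because Ω is connected.

Testing ∇·F = 0 with σχ², χ a cutoff at scale R, gives ∫Dχ² ≤ -2∫σχ F·∇χ. Cauchy–Schwarz for the
form A(x), together with the bounds on φ, A and η, yields |σF·∇χ|² ≤ M D|∇χ|²; no lower bound on the
ellipticity enters. As |∇χ| ≤ C/R lives on R ≤ |x| ≤ 2R, where Ω has volume O(R²), Young's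
inequality gives ∫Dχ² ≤ θ∫_{|x|≥R} Dχ² + P/θ for every θ > 0. Taking θ = 1/2 shows that D is
integrable; letting R → ∞ and then θ → ∞ gives ∫D = 0 (`eqOn_zero_of_integral_cutoff_le`,
`fderiv_apply_eq_zero_of_quadraticGrowth`).

No divergence theorem on Ω is used. The test function is also cut off near ∂Ω by S(kd), with S a
smooth step and d > 0 a function decaying at ∂Ω. If |F·∇d| ≤ Cd locally (`VanishingFluxAt`), the
extra term is bounded because sS'(s) is, and it tends to zero pointwise, so it disappears in the
limit (`weak_form_of_distance_like`). In the Dirichlet case d = φ+ψ works without any Hopf lemma. In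
the Robin case the γ terms cancel, the Wronskian field is tangent to ∂Ω, and d = -ρ works for a
defining function ρ (`exists_abs_fderiv_definingFunction_le`). -/

/-- Fatou's lemma for integrals of nonnegative real functions. -/
theorem integrable_and_integral_le_of_tendsto {X : Type*} [MeasurableSpace X] {μ : Measure X}
    {f : ℕ → X → ℝ} {g : X → ℝ} {a : ℝ} (hf : ∀ k, Integrable (f k) μ)
    (hf0 : ∀ᵐ x ∂μ, ∀ k, 0 ≤ f k x)
    (hfg : ∀ᵐ x ∂μ, Tendsto (fun k => f k x) atTop (𝓝 (g x)))
    (ha : Tendsto (fun k => ∫ x, f k x ∂μ) atTop (𝓝 a)) :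
    Integrable g μ ∧ ∫ x, g x ∂μ ≤ a := by
  have hgm : AEStronglyMeasurable g μ :=
    aestronglyMeasurable_of_tendsto_ae _ (fun k => (hf k).aestronglyMeasurable) hfg
  have hg0 : ∀ᵐ x ∂μ, 0 ≤ g x := by
    filter_upwards [hf0, hfg] with x h0 hl
    exact ge_of_tendsto' hl h0
  have ha0 : 0 ≤ a := ge_of_tendsto' ha fun k =>
    integral_nonneg_of_ae (hf0.mono fun x hx => hx k)
  have key : ∫⁻ x, ENNReal.ofReal (g x) ∂μ ≤ ENNReal.ofReal a := by
    calc ∫⁻ x, ENNReal.ofReal (g x) ∂μ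
        = ∫⁻ x, liminf (fun k => ENNReal.ofReal (f k x)) atTop ∂μ := by
          refine lintegral_congr_ae ?_
          filter_upwards [hfg] with x hl
          exact ((ENNReal.continuous_ofReal.tendsto _).comp hl).liminf_eq.symm
      _ ≤ liminf (fun k => ∫⁻ x, ENNReal.ofReal (f k x) ∂μ) atTop :=
          lintegral_liminf_le' fun k => (hf k).aestronglyMeasurable.aemeasurable.ennreal_ofReal
      _ = liminf (fun k => ENNReal.ofReal (∫ x, f k x ∂μ)) atTop := by
          congr 1; funext k
          rw [ofReal_integral_eq_lintegral_ofReal (hf k) (hf0.mono fun x hx => hx k)]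
      _ = ENNReal.ofReal a := ((ENNReal.continuous_ofReal.tendsto _).comp ha).liminf_eq
  refine ⟨⟨hgm, ?_⟩, ?_⟩
  · rw [hasFiniteIntegral_iff_ofReal hg0]
    exact key.trans_lt ENNReal.ofReal_lt_top
  · rw [integral_eq_lintegral_of_nonneg_ae hg0 hgm]
    exact ENNReal.toReal_le_of_le_ofReal ha0 key

/-! ### Divergence: product rule and vanishing integral -/

theorem divergence_eq_of_eventuallyEq {n : ℕ} {F G : E n → E n} {x : E n} (h : F =ᶠ[𝓝 x] G) :
    divergence F x = divergence G x := by
  simp [divergence, h.fderiv_eq]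

theorem divergence_smul {n : ℕ} {f : E n → ℝ} {F : E n → E n} {x : E n}
    (hf : DifferentiableAt ℝ f x) (hF : DifferentiableAt ℝ F x) :
    divergence (fun y => f y • F y) x = f x * divergence F x + fderiv ℝ f x (F x) := by
  have hexp : fderiv ℝ f x (F x)
      = ∑ i : Fin n, fderiv ℝ f x (EuclideanSpace.single i 1) * F x i := by
    conv_lhs => rw [← (EuclideanSpace.basisFun (Fin n) ℝ).sum_repr (F x)]
    simp [map_sum, mul_comm]
  rw [hexp, divergence, divergence, Finset.mul_sum, ← Finset.sum_add_distrib]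
  refine Finset.sum_congr rfl fun i _ => ?_
  rw [fderiv_fun_smul hf hF]
  simp

theorem divergence_sub {n : ℕ} {F G : E n → E n} {x : E n}
    (hF : DifferentiableAt ℝ F x) (hG : DifferentiableAt ℝ G x) :
    divergence (fun y => F y - G y) x = divergence F x - divergence G x := by
  rw [divergence, divergence, divergence, ← Finset.sum_sub_distrib]
  refine Finset.sum_congr rfl fun i _ => ?_
  rw [fderiv_fun_sub hF hG]
  simp

/-- The divergence of a compactly supported field has zero integral. -/
theorem integral_divergence_eq_zero {n : ℕ} {F : E n → E n} (hF : ContDiff ℝ 1 F)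
    (hc : HasCompactSupport F) : ∫ x, divergence F x = 0 := by
  have hint : ∀ v : E n, Integrable (fun x => fderiv ℝ F x v) := fun v =>
    ((hF.continuous_fderiv one_ne_zero).clm_apply continuous_const).integrable_of_hasCompactSupport
      (hc.fderiv_apply ℝ v)
  have hzero : ∀ v : E n, ∫ x, fderiv ℝ F x v = 0 := fun v => by
    -- Integration by parts against the constant function 1.
    have h := integral_smul_fderiv_eq_neg_fderiv_smul_of_integrable (𝕜 := ℝ) (μ := volume)
      (f := fun _ : E n => (1 : ℝ)) (g := F) (v := v)
      (by simp) (by simpa using hint v)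
      (by simpa using hF.continuous.integrable_of_hasCompactSupport hc)
      (fun x _ => differentiableAt_const _) (fun x _ => hF.differentiable one_ne_zero x)
    simpa using h
  have hcoord : ∀ (v : E n) (i : Fin n), Integrable (fun x => fderiv ℝ F x v i) ∧
      ∫ x, fderiv ℝ F x v i = 0 := fun v i => by
    refine ⟨(EuclideanSpace.proj (𝕜 := ℝ) i : E n →L[ℝ] ℝ).integrable_comp (hint v), ?_⟩
    have := (EuclideanSpace.proj (𝕜 := ℝ) i : E n →L[ℝ] ℝ).integral_comp_comm (hint v)
    simpa [hzero v] using this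
  simp only [divergence]
  rw [integral_finsetSum _ fun i _ => (hcoord _ i).1]
  exact Finset.sum_eq_zero fun i _ => (hcoord _ i).2

/-! ### Weak form up to the boundary -/

/-- A smooth step vanishing on `(-∞, 1]` and equal to `1` on `[2, ∞)`. -/
def smoothStep (s : ℝ) : ℝ := Real.smoothTransition (s - 1)

theorem contDiff_smoothStep : ContDiff ℝ 1 smoothStep :=
  Real.smoothTransition.contDiff.comp (contDiff_id.sub contDiff_const)

theorem smoothStep_nonneg (s : ℝ) : 0 ≤ smoothStep s := Real.smoothTransition.nonneg _

theorem smoothStep_le_one (s : ℝ) : smoothStep s ≤ 1 := Real.smoothTransition.le_one _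

theorem smoothStep_of_le_one {s : ℝ} (hs : s ≤ 1) : smoothStep s = 0 :=
  Real.smoothTransition.zero_of_nonpos (by linarith)

theorem smoothStep_of_two_le {s : ℝ} (hs : 2 ≤ s) : smoothStep s = 1 :=
  Real.smoothTransition.one_of_one_le (by linarith)

theorem deriv_smoothStep_of_two_lt {s : ℝ} (hs : 2 < s) : deriv smoothStep s = 0 := by
  have : smoothStep =ᶠ[𝓝 s] fun _ => 1 := by
    filter_upwards [lt_mem_nhds hs] with t ht using smoothStep_of_two_le ht.le
  rw [this.deriv_eq, deriv_const]

/-- The derivative vanishes beyond 2, so compactness of [0, 2] suffices. This scale-invariant bound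
makes the cutoffs S(kd) usable uniformly in k. -/
theorem exists_abs_mul_deriv_smoothStep_le : ∃ C, ∀ s, 0 ≤ s → |s * deriv smoothStep s| ≤ C := by
  have hcont : Continuous fun s => s * deriv smoothStep s :=
    continuous_id.mul (contDiff_smoothStep.continuous_deriv le_rfl)
  obtain ⟨C, hC⟩ := (isCompact_Icc (a := (0 : ℝ)) (b := 2)).exists_bound_of_continuousOn
    hcont.continuousOn
  refine ⟨C, fun s hs => ?_⟩
  rcases le_or_gt s 2 with h | h
  · exact hC s ⟨hs, h⟩
  · rw [deriv_smoothStep_of_two_lt h, mul_zero, abs_zero]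
    exact (norm_nonneg _).trans (hC 0 (by simp))

theorem continuousOn_fderiv_apply {n : ℕ} {O : Set (E n)} (hO : IsOpen O) {u : E n → ℝ}
    {F : E n → E n} (hu : ContDiffOn ℝ 1 u O) (hF : ContinuousOn F O) :
    ContinuousOn (fun x => fderiv ℝ u x (F x)) O :=
  (hu.continuousOn_fderiv_of_isOpen hO le_rfl).clm_apply hF

/-- A solenoidal field is orthogonal to the gradients of compactly supported functions. -/
theorem integral_fderiv_apply_eq_zero {n : ℕ} {O K : Set (E n)} (hO : IsOpen O)
    {F : E n → E n} (hF : ContDiffOn ℝ 1 F O) (hdiv : ∀ x ∈ O, divergence F x = 0)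
    {u : E n → ℝ} (hu : ContDiffOn ℝ 1 u O) (hK : IsCompact K) (hKO : K ⊆ O)
    (huK : ∀ x ∈ O, x ∉ K → u x = 0) :
    IntegrableOn (fun x => fderiv ℝ u x (F x)) O ∧ ∫ x in O, fderiv ℝ u x (F x) = 0 := by
  -- Extending uF by zero gives a C¹ field on the whole space, since u vanishes off a compact subset
  -- of O; its divergence is F·∇u because F is solenoidal.
  set W : E n → E n := O.indicator fun x => u x • F x with hW
  have hWK : ∀ x ∉ K, W x = 0 := fun x hx => by
    by_cases hxO : x ∈ O
    · simp [hW, hxO, huK x hxO hx]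
    · simp [hW, hxO]
  have hWO : ∀ x ∈ O, W =ᶠ[𝓝 x] fun x => u x • F x := fun x hx => by
    filter_upwards [hO.mem_nhds hx] with y hy
    simp [hW, hy]
  have hWloc : ∀ x ∉ K, W =ᶠ[𝓝 x] fun _ => 0 := fun x hx => by
    filter_upwards [hK.isClosed.isOpen_compl.mem_nhds hx] with y hy using hWK y hy
  have hWd : ContDiff ℝ 1 W := by
    refine contDiff_iff_contDiffAt.2 fun x => ?_
    by_cases hx : x ∈ K
    · exact (((hu.smul hF).contDiffAt (hO.mem_nhds (hKO hx))).congr_of_eventuallyEq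
        (hWO x (hKO hx)))
    · exact contDiffAt_const.congr_of_eventuallyEq (hWloc x hx)
  have hWc : HasCompactSupport W := HasCompactSupport.intro hK hWK
  have hdivW : divergence W = O.indicator fun x => fderiv ℝ u x (F x) := by
    funext x
    by_cases hx : x ∈ O
    · have hx' := hO.mem_nhds hx
      rw [divergence_eq_of_eventuallyEq (hWO x hx), divergence_smul
        ((hu.contDiffAt hx').differentiableAt one_ne_zero)
        ((hF.contDiffAt hx').differentiableAt one_ne_zero), hdiv x hx, mul_zero, zero_add,
        indicator_of_mem hx]
    · rw [divergence_eq_of_eventuallyEq (hWloc x fun h => hx (hKO h)), indicator_of_notMem hx]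
      simp [divergence]
  have hcont : Continuous (divergence W) := by
    unfold divergence
    refine continuous_finsetSum _ fun i _ => ?_
    exact (EuclideanSpace.proj (𝕜 := ℝ) i : E n →L[ℝ] ℝ).continuous.comp
      ((hWd.continuous_fderiv one_ne_zero).clm_apply continuous_const)
  have hcs : HasCompactSupport (divergence W) := by
    refine HasCompactSupport.intro hK fun x hx => ?_
    rw [divergence_eq_of_eventuallyEq (hWloc x hx)]
    simp [divergence]
  have h1 := hcont.integrable_of_hasCompactSupport hcs (μ := volume)
  have h2 := integral_divergence_eq_zero hWd hWc
  rw [hdivW] at h1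
  refine ⟨(integrable_indicator_iff hO.measurableSet).1 h1, ?_⟩
  rw [← integral_indicator hO.measurableSet, ← hdivW, h2]

theorem integrableOn_of_bounded_of_zero {n : ℕ} {O K : Set (E n)} (hO : IsOpen O)
    (hK : IsCompact K) {f : E n → ℝ} {C : ℝ} (hf : ContinuousOn f O)
    (hfK : ∀ x ∈ O, |f x| ≤ K.indicator (fun _ => C) x) : IntegrableOn f O := by
  have hI : Integrable (K.indicator fun _ => C) (volume.restrict O) :=
    ((integrableOn_const hK.measure_lt_top.ne).integrable_indicator hK.measurableSet).integrableOn
  refine hI.mono' (hf.aestronglyMeasurable hO.measurableSet) ?_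
  filter_upwards [ae_restrict_mem hO.measurableSet] with x hx using hfK x hx

/-- Weak form, up to the boundary, of `∇·F = 0`, `F·ν = 0`, tested with `σ ζ`. The vanishing of the
flux of `F` is expressed by means of the boundary-distance-like function `d`. -/
theorem weak_form_of_distance_like {n : ℕ} {O : Set (E n)} (hO : IsOpen O)
    {F : E n → E n} (hF : ContDiffOn ℝ 1 F O) (hdiv : ∀ x ∈ O, divergence F x = 0)
    {σ d ζ : E n → ℝ} (hσ : ContDiffOn ℝ 1 σ O) (hσ1 : ∀ x ∈ O, |σ x| ≤ 1)
    (hD : ∀ x ∈ O, 0 ≤ fderiv ℝ σ x (F x))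
    (hζ : ContDiff ℝ 1 ζ) (hζc : HasCompactSupport ζ) (hζ0 : ∀ x, 0 ≤ ζ x)
    (hFb : ∃ C, ∀ x ∈ O, x ∈ tsupport ζ → ‖F x‖ ≤ C)
    (hd : ContDiffOn ℝ 1 d O) (hdpos : ∀ x ∈ O, 0 < d x)
    (hcomp : ∀ ε > 0, IsCompact {x | x ∈ tsupport ζ ∧ x ∈ O ∧ ε ≤ d x})
    (hFd : ∃ C, ∀ x ∈ O, x ∈ tsupport ζ → |fderiv ℝ d x (F x)| ≤ C * d x) :
    IntegrableOn (fun x => fderiv ℝ σ x (F x) * ζ x) O ∧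
      IntegrableOn (fun x => σ x * fderiv ℝ ζ x (F x)) O ∧
      ∫ x in O, fderiv ℝ σ x (F x) * ζ x ≤ -∫ x in O, σ x * fderiv ℝ ζ x (F x) := by
  obtain ⟨C₁, hC₁⟩ := hFb
  obtain ⟨C₂, hC₂⟩ := hFd
  obtain ⟨C₃, hC₃⟩ := exists_abs_mul_deriv_smoothStep_le
  set K := tsupport ζ with hKdef
  have hK : IsCompact K := hζc
  obtain ⟨Z₀, hZ₀⟩ := hK.exists_bound_of_continuousOn hζ.continuous.continuousOn
  obtain ⟨Z₁, hZ₁⟩ := hK.exists_bound_of_continuousOn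
    (hζ.continuous_fderiv one_ne_zero).continuousOn
  have hζK : ∀ x ∉ K, ζ x = 0 := fun x hx => image_eq_zero_of_notMem_tsupport hx
  have hζK' : ∀ x ∉ K, fderiv ℝ ζ x = 0 := fun x hx =>
    image_eq_zero_of_notMem_tsupport fun h => hx (tsupport_fderiv_subset ℝ h)
  set s : ℕ → ℝ := fun k => (k : ℝ) + 1 with hs
  have hspos : ∀ k, 0 < s k := fun k => by positivity
  set χ : ℕ → E n → ℝ := fun k x => smoothStep (s k * d x) with hχ
  have hχd : ∀ k, ContDiffOn ℝ 1 (χ k) O := fun k =>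
    contDiff_smoothStep.comp_contDiffOn (contDiffOn_const.mul hd)
  have hχ0 : ∀ k x, 0 ≤ χ k x := fun k x => smoothStep_nonneg _
  have hχ1 : ∀ k x, |χ k x| ≤ 1 := fun k x => by
    rw [abs_of_nonneg (hχ0 k x)]; exact smoothStep_le_one _
  have hdiff : ∀ {f : E n → ℝ}, ContDiffOn ℝ 1 f O → ∀ x ∈ O, DifferentiableAt ℝ f x :=
    fun hf x hx => (hf.contDiffAt (hO.mem_nhds hx)).differentiableAt one_ne_zero
  have hχder : ∀ k, ∀ x ∈ O, fderiv ℝ (χ k) x (F x)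
      = deriv smoothStep (s k * d x) * (s k * fderiv ℝ d x (F x)) := fun k x hx => by
    have h1 : HasFDerivAt (fun y => s k * d y) (s k • fderiv ℝ d x) x :=
      (hdiff hd x hx).hasFDerivAt.const_mul (s k)
    have h2 : HasDerivAt smoothStep (deriv smoothStep (s k * d x)) (s k * d x) :=
      (contDiff_smoothStep.differentiable one_ne_zero _).hasDerivAt
    have h3 := h2.comp_hasFDerivAt x h1
    have h4 : fderiv ℝ (χ k) x = deriv smoothStep (s k * d x) • s k • fderiv ℝ d x := h3.fderiv
    rw [h4]; simp
  have hζO : ContDiffOn ℝ 1 ζ O := hζ.contDiffOn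
  -- the three terms produced by the product rule
  set a : ℕ → E n → ℝ := fun k x => fderiv ℝ σ x (F x) * ζ x * χ k x with ha
  set b : ℕ → E n → ℝ := fun k x => σ x * fderiv ℝ ζ x (F x) * χ k x with hb
  set c : ℕ → E n → ℝ := fun k x => σ x * ζ x * fderiv ℝ (χ k) x (F x) with hc
  have hb₀ : ∀ x ∈ O, |σ x * fderiv ℝ ζ x (F x)| ≤ K.indicator (fun _ => Z₁ * C₁) x :=
    fun x hx => by
      by_cases hxK : x ∈ K
      · rw [indicator_of_mem hxK, abs_mul]
        calc |σ x| * |fderiv ℝ ζ x (F x)| ≤ 1 * (‖fderiv ℝ ζ x‖ * ‖F x‖) :=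
              mul_le_mul (hσ1 x hx) ((fderiv ℝ ζ x).le_opNorm _) (abs_nonneg _) zero_le_one
          _ ≤ Z₁ * C₁ := by
              rw [one_mul]
              exact mul_le_mul (hZ₁ x hxK) (hC₁ x hx hxK) (norm_nonneg _)
                ((norm_nonneg _).trans (hZ₁ x hxK))
      · simp [hζK' x hxK, hxK]
  have hbb : ∀ k, ∀ x ∈ O, |b k x| ≤ K.indicator (fun _ => Z₁ * C₁) x := fun k x hx => by
    refine le_trans ?_ (hb₀ x hx)
    rw [hb, abs_mul]
    exact mul_le_of_le_one_right (abs_nonneg _) (hχ1 k x)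
  -- The crucial uniform bound: ∇χₖ·F = S'(sₖd) sₖ ∇d·F is at most C₂ · sₖd|S'(sₖd)|, so the blow-up
  -- of sₖ is compensated by the factor d.
  have hcb : ∀ k, ∀ x ∈ O, |c k x| ≤ K.indicator (fun _ => Z₀ * (C₃ * C₂)) x := fun k x hx => by
    by_cases hxK : x ∈ K
    · rw [indicator_of_mem hxK]
      have hsd : 0 ≤ s k * d x := (mul_pos (hspos k) (hdpos x hx)).le
      have h1 : |fderiv ℝ (χ k) x (F x)| ≤ C₃ * C₂ := by
        rw [hχder k x hx, abs_mul, abs_mul, abs_of_pos (hspos k)]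
        have h2 := hC₃ (s k * d x) hsd
        rw [abs_mul, abs_of_nonneg hsd] at h2
        have hC₂0 : 0 ≤ C₂ := by
          have := (abs_nonneg _).trans (hC₂ x hx hxK)
          exact nonneg_of_mul_nonneg_left this (hdpos x hx)
        calc |deriv smoothStep (s k * d x)| * (s k * |fderiv ℝ d x (F x)|)
            ≤ |deriv smoothStep (s k * d x)| * (s k * (C₂ * d x)) := by
              have := hC₂ x hx hxK
              have := hspos k
              gcongr
          _ = (s k * d x * |deriv smoothStep (s k * d x)|) * C₂ := by ring
          _ ≤ C₃ * C₂ := by gcongr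
      have hZ : |ζ x| ≤ Z₀ := hZ₀ x hxK
      rw [hc, abs_mul, abs_mul]
      calc |σ x| * |ζ x| * |fderiv ℝ (χ k) x (F x)| ≤ 1 * Z₀ * (C₃ * C₂) := by
            have h3 := (abs_nonneg _).trans hZ
            have h4 := hσ1 x hx
            gcongr
        _ = Z₀ * (C₃ * C₂) := by ring
    · simp [hc, hζK x hxK, hxK]
  have hcontF := hF.continuousOn
  have hbcont : ∀ k, ContinuousOn (b k) O := fun k =>
    (hσ.continuousOn.mul (continuousOn_fderiv_apply hO hζO hcontF)).mul (hχd k).continuousOn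
  have hccont : ∀ k, ContinuousOn (c k) O := fun k =>
    (hσ.continuousOn.mul hζO.continuousOn).mul (continuousOn_fderiv_apply hO (hχd k) hcontF)
  have hbint : ∀ k, IntegrableOn (b k) O := fun k =>
    integrableOn_of_bounded_of_zero hO hK (hbcont k) (hbb k)
  have hcint : ∀ k, IntegrableOn (c k) O := fun k =>
    integrableOn_of_bounded_of_zero hO hK (hccont k) (hcb k)
  have hsum : ∀ k, IntegrableOn (a k) O ∧
      ∫ x in O, a k x = -(∫ x in O, b k x) - ∫ x in O, c k x := fun k => by
    have hu : ContDiffOn ℝ 1 (fun x => σ x * ζ x * χ k x) O := (hσ.mul hζO).mul (hχd k)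
    -- The test function σζχₖ vanishes where d < 1/sₖ, hence it lives on a compact subset of O.
    have hz := integral_fderiv_apply_eq_zero hO hF hdiv hu (hcomp (s k)⁻¹ (inv_pos.2 (hspos k)))
      (fun x hx => hx.2.1) (fun x hx hxK => by
        by_cases hxs : x ∈ K
        · have : d x < (s k)⁻¹ := by
            by_contra h
            exact hxK ⟨hxs, hx, not_lt.1 h⟩
          have : s k * d x ≤ 1 := by
            have h := mul_le_mul_of_nonneg_left this.le (hspos k).le
            rwa [mul_inv_cancel₀ (hspos k).ne'] at h
          simp [hχ, smoothStep_of_le_one this]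
        · simp [hζK x hxs])
    have heq : ∀ x ∈ O, fderiv ℝ (fun x => σ x * ζ x * χ k x) x (F x) = a k x + b k x + c k x :=
      fun x hx => by
        rw [fderiv_fun_mul ((hdiff hσ x hx).fun_mul (hdiff hζO x hx)) (hdiff (hχd k) x hx),
          fderiv_fun_mul (hdiff hσ x hx) (hdiff hζO x hx)]
        simp [ha, hb, hc]
        ring
    have hae : ∀ x ∈ O, a k x
        = fderiv ℝ (fun x => σ x * ζ x * χ k x) x (F x) - (b k x + c k x) := fun x hx => by
      rw [heq x hx]; ring
    have hbc : IntegrableOn (fun x => b k x + c k x) O := (hbint k).add (hcint k)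
    refine ⟨((hz.1.sub hbc).congr_fun (fun x hx => (hae x hx).symm) hO.measurableSet), ?_⟩
    rw [setIntegral_congr_fun hO.measurableSet hae, integral_sub hz.1 hbc, hz.2,
      integral_add (hbint k) (hcint k)]
    ring
  have hlarge : ∀ x ∈ O, ∀ᶠ k in atTop, 2 < s k * d x := fun x hx => by
    have : Tendsto (fun k => s k * d x) atTop atTop :=
      (tendsto_atTop_add_const_right _ _ tendsto_natCast_atTop_atTop).atTop_mul_const (hdpos x hx)
    exact this.eventually_gt_atTop 2
  have hIb : ∀ C : ℝ, Integrable (K.indicator fun _ => C) (volume.restrict O) := fun C =>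
    ((integrableOn_const hK.measure_lt_top.ne).integrable_indicator hK.measurableSet).integrableOn
  have hblim : Tendsto (fun k => ∫ x in O, b k x) atTop
      (𝓝 (∫ x in O, σ x * fderiv ℝ ζ x (F x))) := by
    refine tendsto_integral_of_dominated_convergence _
      (fun k => (hbint k).aestronglyMeasurable) (hIb (Z₁ * C₁)) (fun k => ?_) ?_
    · filter_upwards [ae_restrict_mem hO.measurableSet] with x hx using hbb k x hx
    · filter_upwards [ae_restrict_mem hO.measurableSet] with x hx
      refine tendsto_const_nhds.congr' ?_
      filter_upwards [hlarge x hx] with k hk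
      simp [hb, hχ, smoothStep_of_two_le hk.le]
  -- At a fixed point sₖd eventually exceeds 2, where S' = 0; the uniform bound then permits
  -- dominated convergence.
  have hclim : Tendsto (fun k => ∫ x in O, c k x) atTop (𝓝 0) := by
    have h := tendsto_integral_of_dominated_convergence (μ := volume.restrict O)
      (F := c) (f := fun _ => 0) _
      (fun k => (hcint k).aestronglyMeasurable) (hIb (Z₀ * (C₃ * C₂))) (fun k => ?_) ?_
    · simpa using h
    · filter_upwards [ae_restrict_mem hO.measurableSet] with x hx using hcb k x hx
    · filter_upwards [ae_restrict_mem hO.measurableSet] with x hx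
      refine tendsto_const_nhds.congr' ?_
      filter_upwards [hlarge x hx] with k hk
      simp [hc, hχder k x hx, deriv_smoothStep_of_two_lt hk]
  have halim : Tendsto (fun k => ∫ x in O, a k x) atTop
      (𝓝 (-∫ x in O, σ x * fderiv ℝ ζ x (F x))) := by
    have := hblim.neg.sub hclim
    rw [sub_zero] at this
    exact this.congr fun k => (hsum k).2.symm
  -- Integrability of ζF·∇σ is not known beforehand, so Fatou's lemma supplies it, along with an
  -- inequality, which is all that is needed.
  have hfatou := integrable_and_integral_le_of_tendsto (μ := volume.restrict O) (f := a)
    (g := fun x => fderiv ℝ σ x (F x) * ζ x) (fun k => (hsum k).1)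
    (by
      filter_upwards [ae_restrict_mem hO.measurableSet] with x hx k
      exact mul_nonneg (mul_nonneg (hD x hx) (hζ0 x)) (hχ0 k x))
    (by
      filter_upwards [ae_restrict_mem hO.measurableSet] with x hx
      refine tendsto_const_nhds.congr' ?_
      filter_upwards [hlarge x hx] with k hk
      simp [ha, hχ, smoothStep_of_two_le hk.le])
    halim
  exact ⟨hfatou.1, integrableOn_of_bounded_of_zero hO hK
    (hσ.continuousOn.mul (continuousOn_fderiv_apply hO hζO hcontF)) hb₀, hfatou.2⟩

/-- The flux of `F` through `∂Ω` vanishes near `p`, in the sense that `F` is almost tangent to the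
level sets of some positive function `d` that tends to zero at `∂Ω`. -/
def VanishingFluxAt {n : ℕ} (Ω : Set (E n)) (F : E n → E n) (p : E n) : Prop :=
  ∃ (V : Set (E n)) (d : E n → ℝ), IsOpen V ∧ p ∈ V ∧ ContDiffOn ℝ 1 d (Ω ∩ V) ∧
    (∀ x ∈ Ω ∩ V, 0 < d x) ∧
    (∀ K ⊆ V, IsCompact K → ∀ ε > 0, IsCompact {x | x ∈ K ∧ x ∈ Ω ∧ ε ≤ d x}) ∧
    ∀ K ⊆ V, IsCompact K → ∃ C, ∀ x ∈ Ω, x ∈ K → |fderiv ℝ d x (F x)| ≤ C * d x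

/-- Localization: both integrands vanish on Ω off V, so the integrals over Ω ∩ V and over Ω agree.
-/
theorem weak_form_of_tsupport_subset {n : ℕ} {Ω V : Set (E n)} (hΩ : IsOpen Ω) (hV : IsOpen V)
    {F : E n → E n} (hF : ContDiffOn ℝ 1 F Ω) (hdiv : ∀ x ∈ Ω, divergence F x = 0)
    (hFb : ∀ K, IsCompact K → ∃ C, ∀ x ∈ Ω, x ∈ K → ‖F x‖ ≤ C)
    {σ d ζ : E n → ℝ} (hσ : ContDiffOn ℝ 1 σ Ω) (hσ1 : ∀ x ∈ Ω, |σ x| ≤ 1)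
    (hD : ∀ x ∈ Ω, 0 ≤ fderiv ℝ σ x (F x)) (hd : ContDiffOn ℝ 1 d (Ω ∩ V))
    (hdpos : ∀ x ∈ Ω ∩ V, 0 < d x)
    (hcomp : ∀ K ⊆ V, IsCompact K → ∀ ε > 0, IsCompact {x | x ∈ K ∧ x ∈ Ω ∧ ε ≤ d x})
    (hFd : ∀ K ⊆ V, IsCompact K → ∃ C, ∀ x ∈ Ω, x ∈ K → |fderiv ℝ d x (F x)| ≤ C * d x)
    (hζ : ContDiff ℝ 1 ζ) (hζc : HasCompactSupport ζ) (hζ0 : ∀ x, 0 ≤ ζ x)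
    (hζV : tsupport ζ ⊆ V) :
    IntegrableOn (fun x => fderiv ℝ σ x (F x) * ζ x) Ω ∧
      IntegrableOn (fun x => σ x * fderiv ℝ ζ x (F x)) Ω ∧
      ∫ x in Ω, fderiv ℝ σ x (F x) * ζ x ≤ -∫ x in Ω, σ x * fderiv ℝ ζ x (F x) := by
  have hsub : Ω ∩ V ⊆ Ω := inter_subset_left
  obtain ⟨C₁, hC₁⟩ := hFb _ hζc
  obtain ⟨C₂, hC₂⟩ := hFd _ hζV hζc
  have h := weak_form_of_distance_like (hΩ.inter hV) (hF.mono hsub) (fun x hx => hdiv x hx.1)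
    (hσ.mono hsub) (fun x hx => hσ1 x hx.1) (fun x hx => hD x hx.1) hζ hζc hζ0
    ⟨C₁, fun x hx => hC₁ x hx.1⟩ hd hdpos
    (fun ε hε => by
      convert hcomp _ hζV hζc ε hε using 1
      ext x
      constructor
      · rintro ⟨h1, h2, h3⟩; exact ⟨h1, h2.1, h3⟩
      · rintro ⟨h1, h2, h3⟩; exact ⟨h1, ⟨h2, hζV h1⟩, h3⟩)
    ⟨C₂, fun x hx => hC₂ x hx.1⟩
  have hz1 : ∀ x ∈ Ω, x ∉ Ω ∩ V → fderiv ℝ σ x (F x) * ζ x = 0 := fun x hx hxV => by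
    rw [image_eq_zero_of_notMem_tsupport (f := ζ) fun h => hxV ⟨hx, hζV h⟩, mul_zero]
  have hz2 : ∀ x ∈ Ω, x ∉ Ω ∩ V → σ x * fderiv ℝ ζ x (F x) = 0 := fun x hx hxV => by
    rw [image_eq_zero_of_notMem_tsupport (f := fderiv ℝ ζ)
      fun h => hxV ⟨hx, hζV (tsupport_fderiv_subset ℝ h)⟩]
    simp
  have e1 := setIntegral_eq_of_subset_of_forall_sdiff_eq_zero (μ := volume) hΩ.measurableSet hsub
    (fun x hx => hz1 x hx.1 hx.2)
  have e2 := setIntegral_eq_of_subset_of_forall_sdiff_eq_zero (μ := volume) hΩ.measurableSet hsub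
    (fun x hx => hz2 x hx.1 hx.2)
  refine ⟨h.1.of_forall_sdiff_eq_zero hΩ.measurableSet fun x hx => hz1 x hx.1 hx.2,
    h.2.1.of_forall_sdiff_eq_zero hΩ.measurableSet fun x hx => hz2 x hx.1 hx.2, ?_⟩
  rw [e1, e2]
  exact h.2.2

/-- Weak form of `∇·F = 0` in `Ω`, `F·ν = 0` on `∂Ω`. -/
theorem weak_form {n : ℕ} {Ω : Set (E n)} (hΩ : IsOpen Ω)
    {F : E n → E n} (hF : ContDiffOn ℝ 1 F Ω) (hdiv : ∀ x ∈ Ω, divergence F x = 0)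
    (hFb : ∀ K, IsCompact K → ∃ C, ∀ x ∈ Ω, x ∈ K → ‖F x‖ ≤ C)
    (hflux : ∀ p, VanishingFluxAt Ω F p)
    {σ ζ : E n → ℝ} (hσ : ContDiffOn ℝ 1 σ Ω) (hσ1 : ∀ x ∈ Ω, |σ x| ≤ 1)
    (hD : ∀ x ∈ Ω, 0 ≤ fderiv ℝ σ x (F x))
    (hζ : ContDiff ℝ 1 ζ) (hζc : HasCompactSupport ζ) (hζ0 : ∀ x, 0 ≤ ζ x) :
    IntegrableOn (fun x => fderiv ℝ σ x (F x) * ζ x) Ω ∧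
      IntegrableOn (fun x => σ x * fderiv ℝ ζ x (F x)) Ω ∧
      ∫ x in Ω, fderiv ℝ σ x (F x) * ζ x ≤ -∫ x in Ω, σ x * fderiv ℝ ζ x (F x) := by
  choose V d hVo hpV hd hdpos hcomp hFd using hflux
  -- The local weak forms are glued by splitting ζ. Only finitely many pieces meet its compact
  -- support, and nonnegativity of each piece preserves the inequality.
  obtain ⟨f, hf⟩ := SmoothPartitionOfUnity.exists_isSubordinate 𝓘(ℝ, E n)
    (isClosed_univ (X := E n)) V hVo fun x _ => mem_iUnion.2 ⟨x, hpV x⟩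
  have hfin : {i | (Function.support (f i) ∩ tsupport ζ).Nonempty}.Finite :=
    f.locallyFinite.finite_nonempty_inter_compact hζc
  set T := hfin.toFinset with hT
  have hfd : ∀ i, ContDiff ℝ 1 (f i) := fun i =>
    ((f i).contMDiff.contDiff).of_le (by exact_mod_cast le_top)
  have hgd : ∀ i, ContDiff ℝ 1 (fun x => f i x * ζ x) := fun i => (hfd i).mul hζ
  have hsum : ζ = fun x => ∑ i ∈ T, f i x * ζ x := by
    funext x
    by_cases hx : x ∈ tsupport ζ
    · have h1 : ∑ᶠ i, f i x = ∑ i ∈ T, f i x := by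
        refine finsum_eq_sum_of_support_subset _ fun i hi => ?_
        simp only [hT, Finite.coe_toFinset, mem_ofPred_eq]
        exact ⟨x, hi, hx⟩
      rw [← Finset.sum_mul, ← h1, f.sum_eq_one (mem_univ x), one_mul]
    · simp [image_eq_zero_of_notMem_tsupport hx]
  have hloc : ∀ i, IntegrableOn (fun x => fderiv ℝ σ x (F x) * (f i x * ζ x)) Ω ∧
      IntegrableOn (fun x => σ x * fderiv ℝ (fun y => f i y * ζ y) x (F x)) Ω ∧
      ∫ x in Ω, fderiv ℝ σ x (F x) * (f i x * ζ x)
        ≤ -∫ x in Ω, σ x * fderiv ℝ (fun y => f i y * ζ y) x (F x) := fun i =>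
    weak_form_of_tsupport_subset hΩ (hVo i) hF hdiv hFb hσ hσ1 hD (hd i) (hdpos i) (hcomp i)
      (hFd i) (hgd i) hζc.mul_left (fun x => mul_nonneg (f.nonneg i x) (hζ0 x))
      ((closure_mono (Function.support_mul_subset_left _ _)).trans (hf i))
  have e1 : ∀ x, fderiv ℝ σ x (F x) * ζ x = ∑ i ∈ T, fderiv ℝ σ x (F x) * (f i x * ζ x) :=
    fun x => by
      rw [← Finset.mul_sum]
      exact congrArg _ (congrFun hsum x)
  have e2 : ∀ x, σ x * fderiv ℝ ζ x (F x)
      = ∑ i ∈ T, σ x * fderiv ℝ (fun y => f i y * ζ y) x (F x) := fun x => by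
    rw [← Finset.mul_sum]
    congr 1
    conv_lhs => rw [hsum]
    rw [fderiv_fun_sum fun i _ => (hgd i).differentiable one_ne_zero x]
    simp
  simp only [e1, e2]
  refine ⟨integrable_finsetSum _ fun i _ => (hloc i).1,
    integrable_finsetSum _ fun i _ => (hloc i).2.1, ?_⟩
  rw [integral_finsetSum _ fun i _ => (hloc i).1, integral_finsetSum _ fun i _ => (hloc i).2.1,
    ← Finset.sum_neg_distrib]
  exact Finset.sum_le_sum fun i _ => (hloc i).2.2

/-! ### Cutoffs at infinity and the Liouville argument -/

/-- Cutoff functions at scale `R`. -/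
theorem exists_cutoff (n : ℕ) : ∃ C : ℝ, 0 ≤ C ∧ ∀ R : ℝ, 0 < R → ∃ χ : E n → ℝ,
    ContDiff ℝ 1 χ ∧ HasCompactSupport χ ∧ (∀ x, 0 ≤ χ x) ∧ (∀ x, χ x ≤ 1) ∧
    (∀ x, ‖x‖ < R → χ x = 1 ∧ fderiv ℝ χ x = 0) ∧ (∀ x, 2 * R < ‖x‖ → fderiv ℝ χ x = 0) ∧
    ∀ x, ‖fderiv ℝ χ x‖ ≤ C / R := by
  let ξ : ContDiffBump (0 : E n) := ⟨1, 2, one_pos, one_lt_two⟩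
  have hξ : ContDiff ℝ 1 ξ := ξ.contDiff
  obtain ⟨C, hC⟩ := (hξ.continuous_fderiv one_ne_zero).bounded_above_of_compact_support
    (ξ.hasCompactSupport.fderiv ℝ)
  refine ⟨C, (norm_nonneg _).trans (hC 0), fun R hR => ⟨fun x => ξ (R⁻¹ • x), ?_, ?_,
    fun x => ξ.nonneg, fun x => ξ.le_one, fun x hx => ?_, fun x hx => ?_, fun x => ?_⟩⟩
  · exact hξ.comp (contDiff_const_smul _)
  · exact ξ.hasCompactSupport.comp_smul (inv_ne_zero hR.ne')
  · have hone : ∀ y : E n, ‖y‖ < R → ξ (R⁻¹ • y) = 1 := fun y hy => by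
      refine ξ.one_of_mem_closedBall ?_
      simp only [mem_closedBall_zero_iff, norm_smul, norm_inv, Real.norm_eq_abs, abs_of_pos hR, ξ]
      rw [inv_mul_le_iff₀ hR, mul_one]
      exact hy.le
    refine ⟨hone x hx, ?_⟩
    have : (fun y => ξ (R⁻¹ • y)) =ᶠ[𝓝 x] fun _ => 1 := by
      filter_upwards [(isOpen_lt continuous_norm continuous_const).mem_nhds hx] with y hy
        using hone y hy
    rw [this.fderiv_eq]
    simp
  · have : (fun y => ξ (R⁻¹ • y)) =ᶠ[𝓝 x] fun _ => 0 := by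
      filter_upwards [(isOpen_lt continuous_const continuous_norm).mem_nhds hx] with y hy
      refine ξ.zero_of_le_dist ?_
      simp only [dist_zero_right, norm_smul, norm_inv, Real.norm_eq_abs, abs_of_pos hR, ξ]
      rw [le_inv_mul_iff₀ hR, mul_comm]
      exact le_of_lt hy
    rw [this.fderiv_eq]
    simp
  · rw [fderiv_comp_smul, norm_smul, norm_inv, Real.norm_eq_abs, abs_of_pos hR, div_eq_inv_mul]
    exact mul_le_mul_of_nonneg_left (hC _) (inv_nonneg.2 hR.le)

/-- A nonnegative function is zero if its integrals against cutoffs at scale `R` are controlled by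
those over `{R ≤ |x|}`, up to an error that is arbitrarily small compared with the latter. -/
theorem eqOn_zero_of_integral_cutoff_le {n : ℕ} {Ω : Set (E n)} (hΩ : IsOpen Ω)
    {D : E n → ℝ} (hDc : ContinuousOn D Ω) (hD : ∀ x ∈ Ω, 0 ≤ D x) {ζ : ℕ → E n → ℝ}
    (hζ0 : ∀ k x, 0 ≤ ζ k x) (hζ1 : ∀ k x, ζ k x ≤ 1)
    (hζ : ∀ (k : ℕ) (x : E n), ‖x‖ < k + 1 → ζ k x = 1)
    (hint : ∀ k, IntegrableOn (fun x => D x * ζ k x) Ω) {P : ℝ} {k₀ : ℕ}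
    (hle : ∀ θ : ℝ, 0 < θ → ∀ k, k₀ ≤ k → ∫ x in Ω, D x * ζ k x ≤
      θ * (∫ x in Ω, {y : E n | (k : ℝ) + 1 ≤ ‖y‖}.indicator (fun y => D y * ζ k y) x) + θ⁻¹ * P) :
    EqOn D 0 Ω := by
  have hms : ∀ k : ℕ, MeasurableSet {y : E n | (k : ℝ) + 1 ≤ ‖y‖} := fun k =>
    (isClosed_le continuous_const continuous_norm).measurableSet
  have hae : ∀ᵐ x ∂(volume.restrict Ω), x ∈ Ω := ae_restrict_mem hΩ.measurableSet
  have hlarge : ∀ x : E n, ∀ᶠ k : ℕ in atTop, ‖x‖ < k + 1 := fun x => by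
    have : Tendsto (fun k : ℕ => (k : ℝ) + 1) atTop atTop :=
      tendsto_atTop_add_const_right _ _ tendsto_natCast_atTop_atTop
    exact this.eventually_gt_atTop _
  have hDlim : ∀ x, Tendsto (fun k => D x * ζ k x) atTop (𝓝 (D x)) := fun x => by
    refine tendsto_const_nhds.congr' ?_
    filter_upwards [hlarge x] with k hk
    rw [hζ k x hk, mul_one]
  -- With θ = 1/2 the tail, bounded by the whole integral I, is absorbed: I ≤ I/2 + 2P.
  have hbd : ∀ k, k₀ ≤ k → ∫ x in Ω, D x * ζ k x ≤ 4 * P := fun k hk => by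
    have h := hle (1 / 2) (by norm_num) k hk
    have h2 : (∫ x in Ω, {y : E n | (k : ℝ) + 1 ≤ ‖y‖}.indicator (fun y => D y * ζ k y) x)
        ≤ ∫ x in Ω, D x * ζ k x := by
      refine integral_mono_ae ((hint k).indicator (hms k)) (hint k) ?_
      filter_upwards [hae] with x hx
      exact indicator_le_self' (fun _ _ => mul_nonneg (hD x hx) (hζ0 k x)) x
    norm_num at h
    linarith
  have hDint : IntegrableOn D Ω := by
    have hDm := hDc.aestronglyMeasurable (μ := volume) hΩ.measurableSet
    have hD0 : ∀ᵐ x ∂(volume.restrict Ω), 0 ≤ D x := hae.mono fun x hx => hD x hx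
    refine ⟨hDm, ?_⟩
    rw [hasFiniteIntegral_iff_ofReal hD0]
    refine lt_of_le_of_lt ?_ (ENNReal.ofReal_lt_top (r := 4 * P))
    calc ∫⁻ x in Ω, ENNReal.ofReal (D x)
        = ∫⁻ x in Ω, liminf (fun k => ENNReal.ofReal (D x * ζ k x)) atTop :=
          lintegral_congr fun x =>
            ((ENNReal.continuous_ofReal.tendsto _).comp (hDlim x)).liminf_eq.symm
      _ ≤ liminf (fun k => ∫⁻ x in Ω, ENNReal.ofReal (D x * ζ k x)) atTop :=
          lintegral_liminf_le' fun k => (hint k).aestronglyMeasurable.aemeasurable.ennreal_ofReal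
      _ ≤ ENNReal.ofReal (4 * P) := by
          refine liminf_le_of_le (by isBoundedDefault) fun b hb => ?_
          obtain ⟨k, hk1, hk2⟩ := (hb.and (eventually_ge_atTop k₀)).exists
          refine hk1.trans ?_
          rw [← ofReal_integral_eq_lintegral_ofReal (hint k)
            (hae.mono fun x hx => mul_nonneg (hD x hx) (hζ0 k x))]
          exact ENNReal.ofReal_le_ofReal (hbd k hk2)
  have hlim1 : Tendsto (fun k => ∫ x in Ω, D x * ζ k x) atTop (𝓝 (∫ x in Ω, D x)) := by
    refine tendsto_integral_of_dominated_convergence D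
      (fun k => (hint k).aestronglyMeasurable) hDint (fun k => ?_) (.of_forall hDlim)
    filter_upwards [hae] with x hx
    rw [Real.norm_eq_abs, abs_of_nonneg (mul_nonneg (hD x hx) (hζ0 k x))]
    exact mul_le_of_le_one_right (hD x hx) (hζ1 k x)
  have hlim2 : Tendsto (fun k : ℕ => ∫ x in Ω, {y : E n | (k : ℝ) + 1 ≤ ‖y‖}.indicator
      (fun y => D y * ζ k y) x) atTop (𝓝 0) := by
    have h := tendsto_integral_of_dominated_convergence (μ := volume.restrict Ω)
      (F := fun (k : ℕ) x => {y : E n | (k : ℝ) + 1 ≤ ‖y‖}.indicator (fun y => D y * ζ k y) x)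
      (f := fun _ => 0) D
      (fun k => ((hint k).indicator (hms k)).aestronglyMeasurable) hDint (fun k => ?_) ?_
    · simpa using h
    · filter_upwards [hae] with x hx
      have h0 := mul_nonneg (hD x hx) (hζ0 k x)
      rw [Real.norm_eq_abs, abs_of_nonneg (indicator_apply_nonneg (f := fun y => D y * ζ k y) fun _ => h0)]
      exact (indicator_le_self' (fun _ _ => h0) x).trans
        (mul_le_of_le_one_right (hD x hx) (hζ1 k x))
    · refine .of_forall fun x => tendsto_const_nhds.congr' ?_
      filter_upwards [hlarge x] with k hk
      rw [indicator_of_notMem]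
      simpa using hk
  -- Once D is integrable its tails tend to zero, so only the θ⁻¹ term survives; it vanishes
  -- afterwards as θ → ∞.
  have hlimle : ∀ θ : ℝ, 0 < θ → ∫ x in Ω, D x ≤ θ⁻¹ * P := fun θ hθ => by
    have h := le_of_tendsto_of_tendsto hlim1 ((hlim2.const_mul θ).add_const (θ⁻¹ * P))
      (by filter_upwards [eventually_ge_atTop k₀] with k hk using hle θ hθ k hk)
    simpa using h
  have hle0 : ∫ x in Ω, D x ≤ 0 := by
    have ht : Tendsto (fun θ : ℝ => θ⁻¹ * P) atTop (𝓝 0) := by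
      simpa using tendsto_inv_atTop_zero.mul_const P
    refine ge_of_tendsto ht ?_
    filter_upwards [eventually_gt_atTop 0] with θ hθ using hlimle θ hθ
  have hD0 : 0 ≤ᵐ[volume.restrict Ω] D := hae.mono fun x hx => hD x hx
  have heq : ∫ x in Ω, D x = 0 := le_antisymm hle0 (integral_nonneg_of_ae hD0)
  have h0 : D =ᵐ[volume.restrict Ω] 0 := (integral_eq_zero_iff_of_nonneg_ae hD0 hDint).1 heq
  exact Measure.eqOn_open_of_ae_eq h0 hΩ hDc continuousOn_const

/-- A Liouville-type theorem: if `F` is solenoidal in `Ω`, with zero flux through `∂Ω`, and its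
product with the bounded function `σ` is controlled by the square root of `F·∇σ`, then `F·∇σ = 0`
as soon as `Ω` has at most quadratic growth. -/
theorem fderiv_apply_eq_zero_of_quadraticGrowth {n : ℕ} {Ω : Set (E n)} (hΩ : IsOpen Ω)
    (hgrowth : QuadraticGrowth Ω)
    {F : E n → E n} (hF : ContDiffOn ℝ 1 F Ω) (hdiv : ∀ x ∈ Ω, divergence F x = 0)
    (hFb : ∀ K, IsCompact K → ∃ C, ∀ x ∈ Ω, x ∈ K → ‖F x‖ ≤ C)
    (hflux : ∀ p, VanishingFluxAt Ω F p)
    {σ : E n → ℝ} (hσ : ContDiffOn ℝ 1 σ Ω) (hσ1 : ∀ x ∈ Ω, |σ x| ≤ 1)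
    (hD : ∀ x ∈ Ω, 0 ≤ fderiv ℝ σ x (F x)) {M : ℝ} (hM : 0 ≤ M)
    (hFσ : ∀ x ∈ Ω, ∀ l : E n →L[ℝ] ℝ, (σ x * l (F x)) ^ 2 ≤ M * fderiv ℝ σ x (F x) * ‖l‖ ^ 2) :
    ∀ x ∈ Ω, fderiv ℝ σ x (F x) = 0 := by
  obtain ⟨C, hC, hcut⟩ := exists_cutoff n
  have hRpos : ∀ k : ℕ, (0 : ℝ) < k + 1 := fun k => by positivity
  choose χ hχd hχc hχ0 hχ1 hχin hχout hχb using fun k : ℕ => hcut (k + 1) (hRpos k)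
  obtain ⟨Q, hQ⟩ := hgrowth.bound
  have hQ' : ∀ᶠ k : ℕ in atTop, ‖(volume (Ω ∩ Metric.closedBall 0 (2 * ((k : ℝ) + 1)))).toReal‖
      ≤ Q * ‖(2 * ((k : ℝ) + 1)) ^ 2‖ := by
    have : Tendsto (fun k : ℕ => 2 * ((k : ℝ) + 1)) atTop atTop :=
      (tendsto_atTop_add_const_right _ _ tendsto_natCast_atTop_atTop).const_mul_atTop two_pos
    exact this.eventually hQ
  obtain ⟨k₀, hk₀⟩ := eventually_atTop.1 hQ'
  have hζd : ∀ k, ContDiff ℝ 1 fun x => χ k x ^ 2 := fun k => (hχd k).pow 2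
  have hζc : ∀ k, HasCompactSupport fun x => χ k x ^ 2 := fun k => by
    have : (fun x => χ k x ^ 2) = fun x => χ k x * χ k x := by funext x; ring
    rw [this]; exact (hχc k).mul_left
  have hweak := fun k => weak_form hΩ hF hdiv hFb hflux hσ hσ1 hD (hζd k) (hζc k)
    fun x => sq_nonneg _
  have hζder : ∀ k x, fderiv ℝ (fun y => χ k y ^ 2) x (F x)
      = 2 * χ k x * fderiv ℝ (χ k) x (F x) := fun k x => by
    have : (fun y => χ k y ^ 2) = fun y => χ k y * χ k y := by funext y; ring
    have hd := (hχd k).differentiable one_ne_zero x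
    rw [this, fderiv_fun_mul hd hd]
    simp; ring
  refine eqOn_zero_of_integral_cutoff_le hΩ (continuousOn_fderiv_apply hΩ hσ hF.continuousOn) hD
    (ζ := fun k x => χ k x ^ 2) (fun k x => sq_nonneg _)
    (fun k x => pow_le_one₀ (hχ0 k x) (hχ1 k x)) (fun (k : ℕ) x hx => by simp [(hχin k x hx).1])
    (fun k => (hweak k).1) (P := M * C ^ 2 * (Q * 4)) (k₀ := k₀) fun θ hθ k hk => ?_
  set R : ℝ := (k : ℝ) + 1 with hR
  have hR0 : 0 < R := hRpos k
  set B : Set (E n) := Metric.closedBall 0 (2 * R) with hB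
  have hBm : MeasurableSet B := Metric.isClosed_closedBall.measurableSet
  -- The remainder density in Young's inequality; its factor R⁻² offsets the volume O(R²).
  set c : ℝ := θ⁻¹ * (M * (C / R) ^ 2) with hc
  have hc0 : 0 ≤ c := by positivity
  have hmsR : MeasurableSet {y : E n | R ≤ ‖y‖} :=
    (isClosed_le continuous_const continuous_norm).measurableSet
  have hpt : ∀ x ∈ Ω, -(σ x * fderiv ℝ (fun y => χ k y ^ 2) x (F x)) ≤
      θ * {y : E n | R ≤ ‖y‖}.indicator (fun y => fderiv ℝ σ y (F y) * χ k y ^ 2) x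
        + B.indicator (fun _ => c) x := fun x hx => by
    have hS0 : 0 ≤ fderiv ℝ σ x (F x) * χ k x ^ 2 := mul_nonneg (hD x hx) (sq_nonneg _)
    -- A nonzero gradient of the cutoff forces R ≤ ‖x‖ ≤ 2R, so that both indicators equal 1.
    by_cases hz : fderiv ℝ (χ k) x = 0
    · rw [hζder, hz]
      have h1 : 0 ≤ {y : E n | R ≤ ‖y‖}.indicator
        (fun y => fderiv ℝ σ y (F y) * χ k y ^ 2) x := indicator_apply_nonneg fun _ => hS0
      have h2 : 0 ≤ B.indicator (fun _ => c) x := indicator_apply_nonneg fun _ => hc0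
      have h3 := mul_nonneg hθ.le h1
      simp only [_root_.zero_apply, mul_zero, neg_zero]
      linarith
    · have hxR : R ≤ ‖x‖ := by
        by_contra h
        exact hz (hχin k x (not_le.1 h)).2
      have hxB : x ∈ B := by
        by_contra h
        refine hz (hχout k x ?_)
        simpa [hB] using h
      rw [indicator_of_mem (show x ∈ {y : E n | R ≤ ‖y‖} from hxR), indicator_of_mem hxB, hζder]
      set Y := σ x * fderiv ℝ (χ k) x (F x) with hY
      have hsq : Y ^ 2 ≤ M * fderiv ℝ σ x (F x) * (C / R) ^ 2 := by
        refine (hFσ x hx _).trans ?_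
        have := hχb k x
        have := mul_nonneg hM (hD x hx)
        gcongr
      have hS : 0 ≤ θ * (fderiv ℝ σ x (F x) * χ k x ^ 2) := mul_nonneg hθ.le hS0
      have hprod : (χ k x * Y) ^ 2 ≤ (θ * (fderiv ℝ σ x (F x) * χ k x ^ 2)) * c := by
        calc (χ k x * Y) ^ 2 = χ k x ^ 2 * Y ^ 2 := by ring
          _ ≤ χ k x ^ 2 * (M * fderiv ℝ σ x (F x) * (C / R) ^ 2) := by gcongr
          _ = (θ * θ⁻¹) * (χ k x ^ 2 * (M * fderiv ℝ σ x (F x) * (C / R) ^ 2)) := by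
              rw [mul_inv_cancel₀ hθ.ne', one_mul]
          _ = _ := by rw [hc]; ring
      -- Arithmetic–geometric mean: 4Sc ≤ (S + c)², with S the θ-weighted energy density.
      have habs : |2 * (χ k x * Y)| ≤ θ * (fderiv ℝ σ x (F x) * χ k x ^ 2) + c := by
        refine abs_le_of_sq_le_sq ?_ (add_nonneg hS hc0)
        nlinarith [sq_nonneg (θ * (fderiv ℝ σ x (F x) * χ k x ^ 2) - c)]
      have := neg_le_of_abs_le habs
      rw [hY] at this
      linarith
  have hIi : IntegrableOn (fun x => {y : E n | R ≤ ‖y‖}.indicator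
      (fun y => fderiv ℝ σ y (F y) * χ k y ^ 2) x) Ω := (hweak k).1.indicator hmsR
  have hIB : IntegrableOn (B.indicator fun _ => c) Ω :=
    ((integrableOn_const (isCompact_closedBall _ _).measure_lt_top.ne).integrable_indicator
      hBm).integrableOn
  have hvol : ∫ x in Ω, B.indicator (fun _ => c) x ≤ θ⁻¹ * (M * C ^ 2 * (Q * 4)) := by
    have h1 : ∫ x in Ω, B.indicator (fun _ => c) x = (volume (Ω ∩ B)).toReal * c := by
      rw [setIntegral_indicator hBm, setIntegral_const, smul_eq_mul, Measure.real]
    have h2 := hk₀ k hk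
    rw [Real.norm_of_nonneg ENNReal.toReal_nonneg, Real.norm_of_nonneg (sq_nonneg _)] at h2
    rw [h1]
    calc (volume (Ω ∩ B)).toReal * c ≤ Q * (2 * R) ^ 2 * c := by gcongr
      _ = θ⁻¹ * (M * C ^ 2 * (Q * 4)) := by
        rw [hc]; field_simp; ring
  calc ∫ x in Ω, fderiv ℝ σ x (F x) * χ k x ^ 2
      ≤ -∫ x in Ω, σ x * fderiv ℝ (fun y => χ k y ^ 2) x (F x) := (hweak k).2.2
    _ = ∫ x in Ω, -(σ x * fderiv ℝ (fun y => χ k y ^ 2) x (F x)) := (integral_neg _).symm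
    _ ≤ ∫ x in Ω, (θ * {y : E n | R ≤ ‖y‖}.indicator
          (fun y => fderiv ℝ σ y (F y) * χ k y ^ 2) x + B.indicator (fun _ => c) x) := by
        refine integral_mono_ae (hweak k).2.1.neg ((hIi.const_mul θ).add hIB) ?_
        filter_upwards [ae_restrict_mem hΩ.measurableSet] with x hx using hpt x hx
    _ = θ * (∫ x in Ω, {y : E n | R ≤ ‖y‖}.indicator
          (fun y => fderiv ℝ σ y (F y) * χ k y ^ 2) x) + ∫ x in Ω, B.indicator (fun _ => c) x := by
        rw [integral_add (hIi.const_mul θ) hIB, integral_const_mul]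
    _ ≤ _ := by gcongr

/-! ### Regular boundaries and tangent fields -/

theorem fderiv_apply_eq_inner_gradient {n : ℕ} (f : E n → ℝ) (x v : E n) :
    fderiv ℝ f x v = inner ℝ (gradient f x) v := by
  simp [gradient]

theorem definingFunction_eq_zero {n : ℕ} {Ω U : Set (E n)} {p : E n} {ρ : E n → ℝ}
    (hΩ : IsOpen Ω) (hp : p ∈ frontier Ω) (hU : IsOpen U) (hpU : p ∈ U)
    (hρ : ContinuousAt ρ p) (hΩU : Ω ∩ U = {x ∈ U | ρ x < 0}) : ρ p = 0 := by
  have hpΩ : p ∉ Ω := by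
    rw [hΩ.frontier_eq] at hp; exact hp.2
  refine le_antisymm (not_lt.1 fun hpos => ?_) (not_lt.1 fun h => hpΩ ?_)
  · obtain ⟨x, ⟨hxU, hx⟩, hxΩ⟩ := mem_closure_iff_nhds.1 (frontier_subset_closure hp) _
      ((hU.eventually_mem hpU).and (hρ.eventually (lt_mem_nhds hpos)))
    have : x ∈ {x ∈ U | ρ x < 0} := hΩU ▸ ⟨hxΩ, hxU⟩
    exact absurd this.2 (not_lt.2 (le_of_lt hx))
  · have : p ∈ Ω ∩ U := hΩU ▸ ⟨hpU, h⟩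
    exact this.1

/-- The tangent cone contains the open half-space of vectors making an obtuse angle with ν, and a
half-space spans. -/
theorem IsOuterUnitNormal.uniqueDiffWithinAt {n : ℕ} {Ω : Set (E n)} {p ν : E n}
    (hp : p ∈ closure Ω) (hν : IsOuterUnitNormal Ω p ν) : UniqueDiffWithinAt ℝ Ω p := by
  refine ⟨?_, hp⟩
  have hνν : inner ℝ ν ν = (1 : ℝ) := by rw [real_inner_self_eq_norm_sq, hν.1]; norm_num
  have hcone : ∀ v : E n, inner ℝ ν v < 0 → v ∈ Submodule.span ℝ (tangentConeAt ℝ Ω p) :=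
    fun v hv => by
      refine Submodule.subset_span ?_
      refine mem_tangentConeAt_of_add_smul_mem (l := 𝓝[>] (0 : ℝ)) (c := id) ?_ (hν.2.1 v hv)
      exact tendsto_id.mono_right (nhdsWithin_mono _ fun t ht => ne_of_gt ht)
  have hall : ∀ w : E n, w ∈ Submodule.span ℝ (tangentConeAt ℝ Ω p) := fun w => by
    have h1 := hcone (-ν) (by rw [inner_neg_right, hνν]; norm_num)
    -- This vector has inner product -1 with ν; adding a multiple of ν recovers w.
    have h2 := hcone (w - (inner ℝ ν w + 1) • ν) (by
      rw [inner_sub_right, real_inner_smul_right, hνν]; linarith)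
    have h3 : w = (w - (inner ℝ ν w + 1) • ν) - (inner ℝ ν w + 1) • (-ν) := by
      rw [smul_neg]; abel
    rw [h3]
    exact Submodule.sub_mem _ h2 (Submodule.smul_mem _ _ h1)
  rw [(Submodule.eq_top_iff'.2 hall : Submodule.span ℝ (tangentConeAt ℝ Ω p) = ⊤)]
  simp

theorem HasRegularBoundary.uniqueDiffOn_closure {n : ℕ} (hn : 1 ≤ n) {α : ℝ≥0} {Ω : Set (E n)}
    (hΩ : IsOpen Ω) (h : HasRegularBoundary α Ω) : UniqueDiffOn ℝ (closure Ω) := by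
  intro p hp
  by_cases hpΩ : p ∈ Ω
  · exact (hΩ.uniqueDiffWithinAt hpΩ).mono subset_closure
  · have hpf : p ∈ frontier Ω := by rw [hΩ.frontier_eq]; exact ⟨hp, hpΩ⟩
    obtain ⟨U, ρ, hU, hpU, hρ, -, h0, hΩU⟩ := h p hpf
    have hd : DifferentiableAt ℝ ρ p := (hρ.contDiffAt (hU.mem_nhds hpU)).differentiableAt
      (by exact_mod_cast (by lia : n ≠ 0))
    exact ((outerNormal_eq_gradient hpf hΩ hU hpU hd (h0 p hpU) hΩU).1.uniqueDiffWithinAt hp).mono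
      subset_closure

/-- In dimension one, the linearization of a defining function is a defining function. -/
theorem exists_linear_definingFunction {Ω U : Set (E 1)} {p : E 1} {ρ : E 1 → ℝ}
    (hU : IsOpen U) (hpU : p ∈ U) (hρ : DifferentiableAt ℝ ρ p) (h0 : fderiv ℝ ρ p ≠ 0)
    (hρp : ρ p = 0) (hΩU : Ω ∩ U = {x ∈ U | ρ x < 0}) :
    ∃ V, IsOpen V ∧ p ∈ V ∧ Ω ∩ V = {x ∈ V | fderiv ℝ ρ p (x - p) < 0} := by
  set l := fderiv ℝ ρ p with hl
  set e : E 1 := EuclideanSpace.single 0 1 with he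
  have hv : ∀ v : E 1, v = v 0 • e := fun v => by
    ext i
    fin_cases i
    simp [he]
  have hlv : ∀ v : E 1, |l v| = |l e| * ‖v‖ := fun v => by
    conv_lhs => rw [hv v]
    rw [map_smul, smul_eq_mul, abs_mul, mul_comm]
    congr 1
    rw [EuclideanSpace.norm_eq]
    simp [Real.sqrt_sq_eq_abs]
  have hle : 0 < |l e| := by
    rw [abs_pos]
    intro h
    refine h0 (ContinuousLinearMap.ext fun v => ?_)
    have := hlv v
    rw [h, abs_zero, zero_mul, abs_eq_zero] at this
    simpa using this
  -- In dimension one |l(x - p)| is proportional to ‖x - p‖, so the linearization error is at most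
  -- half of |l(x - p)| and cannot change the sign.
  have hev : ∀ᶠ x in 𝓝 p, ‖ρ x - ρ p - l (x - p)‖ ≤ (|l e| / 2) * ‖x - p‖ :=
    (hasFDerivAt_iff_isLittleO.1 hρ.hasFDerivAt).bound (half_pos hle)
  obtain ⟨V, hVsub, hV, hpV⟩ := mem_nhds_iff.1 (hev.and (hU.eventually_mem hpU))
  refine ⟨V, hV, hpV, ?_⟩
  ext x
  simp only [mem_inter_iff, mem_ofPred_eq]
  have hiff : x ∈ V → (ρ x < 0 ↔ l (x - p) < 0) := fun hx => by
    have h1 := (hVsub hx).1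
    rw [hρp, sub_zero, Real.norm_eq_abs, abs_le] at h1
    have h2 := hlv (x - p)
    have h3 : (|l e| / 2) * ‖x - p‖ = |l (x - p)| / 2 := by rw [h2]; ring
    rw [h3] at h1
    constructor
    · intro h
      by_contra hc
      rw [abs_of_nonneg (not_lt.1 hc)] at h1
      have := not_lt.1 hc
      linarith
    · intro h
      rw [abs_of_neg h] at h1
      linarith
  have hmem : x ∈ V → (x ∈ Ω ↔ ρ x < 0) := fun hx => by
    have h1 := Set.ext_iff.1 hΩU x
    have h2 : x ∈ U := (hVsub hx).2
    simpa [h2] using h1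
  constructor
  · rintro ⟨h1, h2⟩
    exact ⟨h2, (hiff h2).1 ((hmem h2).1 h1)⟩
  · rintro ⟨h1, h2⟩
    exact ⟨(hmem h1).2 ((hiff h1).2 h2), h1⟩

/-- For n ≥ 2 the class C^n already contains enough derivatives. For n = 1 it gives only C¹, and the
linearization, which is smooth, takes over. -/
theorem HasRegularBoundary.exists_definingFunction {n : ℕ} (hn : 1 ≤ n) {α : ℝ≥0}
    {Ω : Set (E n)} (hΩ : IsOpen Ω) (h : HasRegularBoundary α Ω) {p : E n}
    (hp : p ∈ frontier Ω) :
    ∃ (U : Set (E n)) (ρ : E n → ℝ), IsOpen U ∧ p ∈ U ∧ ContDiffOn ℝ 2 ρ U ∧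
      (∀ x ∈ U, fderiv ℝ ρ x ≠ 0) ∧ Ω ∩ U = {x ∈ U | ρ x < 0} := by
  obtain ⟨U, ρ, hU, hpU, hρ, -, h0, hΩU⟩ := h p hp
  rcases hn.eq_or_lt with rfl | hn2
  · have hd : DifferentiableAt ℝ ρ p :=
      (hρ.contDiffAt (hU.mem_nhds hpU)).differentiableAt (by simp)
    obtain ⟨V, hV, hpV, hΩV⟩ := exists_linear_definingFunction hU hpU hd (h0 p hpU)
      (definingFunction_eq_zero hΩ hp hU hpU hd.continuousAt hΩU) hΩU
    refine ⟨V, fun x => fderiv ℝ ρ p (x - p), hV, hpV, ?_, fun x _ => ?_, hΩV⟩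
    · exact ((fderiv ℝ ρ p).contDiff.comp (contDiff_id.sub contDiff_const)).contDiffOn
    · have : HasFDerivAt (fun x => fderiv ℝ ρ p (x - p)) (fderiv ℝ ρ p) x := by
        exact (fderiv ℝ ρ p).hasFDerivAt.comp x ((hasFDerivAt_id x).sub_const p)
      rw [this.fderiv]
      exact h0 p hpU
  · exact ⟨U, ρ, hU, hpU, hρ.of_le (by exact_mod_cast hn2), h0, hΩU⟩

/-- A `C¹` field that is tangent to `∂Ω` is almost tangent to the level sets of a defining
function of `Ω`. -/
theorem exists_abs_fderiv_definingFunction_le {n : ℕ} {Ω U : Set (E n)} {p : E n} {ρ : E n → ℝ}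
    (hΩ : IsOpen Ω) (hud : UniqueDiffOn ℝ (closure Ω)) (hp : p ∈ frontier Ω)
    (hU : IsOpen U) (hpU : p ∈ U) (hρ : ContDiffOn ℝ 2 ρ U) (h0 : ∀ x ∈ U, fderiv ℝ ρ x ≠ 0)
    (hΩU : Ω ∩ U = {x ∈ U | ρ x < 0}) {G : E n → E n} (hG : ContDiffOn ℝ 1 G (closure Ω))
    (hGν : ∀ q ∈ frontier Ω, inner ℝ (outerNormal Ω q) (G q) = 0) :
    ∃ V ⊆ U, IsOpen V ∧ p ∈ V ∧ ∃ C, 0 ≤ C ∧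
      ∀ x ∈ Ω ∩ V, |fderiv ℝ ρ x (G x)| ≤ C * -ρ x := by
  have hρd : ∀ x ∈ U, DifferentiableAt ℝ ρ x := fun x hx =>
    (hρ.contDiffAt (hU.mem_nhds hx)).differentiableAt two_ne_zero
  have hρ1 : ContDiffOn ℝ 1 (fderiv ℝ ρ) U := hρ.fderiv_of_isOpen hU (by norm_num)
  have hρp := definingFunction_eq_zero hΩ hp hU hpU (hρd p hpU).continuousAt hΩU
  have hmem : ∀ x ∈ U, (x ∈ Ω ↔ ρ x < 0) := fun x hx => by
    have := Set.ext_iff.1 hΩU x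
    simpa [hx] using this
  set S := closure Ω ∩ U with hS
  have hSud : UniqueDiffOn ℝ S := hud.inter hU
  set g : E n → ℝ := fun x => fderiv ℝ ρ x (G x) with hg
  have hgS : ContDiffOn ℝ 1 g S :=
    (hρ1.mono inter_subset_right).clm_apply (hG.mono inter_subset_left)
  have hg0 : ∀ q ∈ frontier Ω, q ∈ U → g q = 0 := fun q hq hqU => by
    have hν := (outerNormal_eq_gradient hq hΩ hU hqU (hρd q hqU) (h0 q hqU) hΩU).2
    have h1 := hGν q hq
    have hgr : ‖gradient ρ q‖ ≠ 0 := by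
      rw [norm_ne_zero_iff]
      simpa [gradient] using h0 q hqU
    rw [hν, real_inner_smul_left] at h1
    rw [hg]
    simp only [fderiv_apply_eq_inner_gradient]
    exact (mul_eq_zero.1 h1).resolve_left (inv_ne_zero hgr)
  obtain ⟨v₀, hv₀⟩ : ∃ v, fderiv ℝ ρ p v ≠ 0 := by
    by_contra hc
    push Not at hc
    exact h0 p hpU (ContinuousLinearMap.ext fun v => by simpa using hc v)
  -- A transversal direction, normalized so that ρ grows at unit rate at p, hence at rate above 1/2
  -- nearby.
  set v : E n := (fderiv ℝ ρ p v₀)⁻¹ • v₀ with hvdef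
  have hv : fderiv ℝ ρ p v = 1 := by
    rw [hvdef, map_smul, smul_eq_mul, inv_mul_cancel₀ hv₀]
  have hev1 : ∀ᶠ x in 𝓝 p, 1 / 2 < fderiv ℝ ρ x v := by
    have hc : ContinuousAt (fun x => fderiv ℝ ρ x v) p :=
      (hρ1.continuousOn.continuousAt (hU.mem_nhds hpU)).clm_apply continuousAt_const
    exact hc.eventually (lt_mem_nhds (by simp only [hv]; norm_num))
  set C₁ : ℝ := ‖fderivWithin ℝ g S p‖ + 1 with hC₁
  have hpS : p ∈ S := ⟨frontier_subset_closure hp, hpU⟩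
  have hev2 : ∀ᶠ x in 𝓝 p, x ∈ S → ‖fderivWithin ℝ g S x‖ < C₁ := by
    have hc : ContinuousWithinAt (fun x => ‖fderivWithin ℝ g S x‖) S p :=
      ((hgS.continuousOn_fderivWithin hSud le_rfl) p hpS).norm
    exact eventually_nhdsWithin_iff.1
      (hc.eventually (gt_mem_nhds (by rw [hC₁]; linarith)))
  obtain ⟨r, hr, hball⟩ := Metric.eventually_nhds_iff_ball.1
    ((hev1.and hev2).and (hU.eventually_mem hpU))
  -- Growth at rate 1/2 brings ρ from ρ(x) to zero within time T = -2ρ(x). Near p the whole segment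
  -- of that duration stays in the ball where the estimates hold.
  have hev3 : ∀ᶠ x in 𝓝 p, (-2 * ρ x) * ‖v‖ < r / 2 := by
    have hc : ContinuousAt (fun x => (-2 * ρ x) * ‖v‖) p :=
      ((hρd p hpU).continuousAt.const_mul (-2)).mul_const _
    exact hc.eventually (gt_mem_nhds (by simpa [hρp] using hr))
  obtain ⟨V, hVsub, hV, hpV⟩ := mem_nhds_iff.1
    (hev3.and (Metric.ball_mem_nhds p (half_pos hr)))
  have hVball : V ⊆ Metric.ball p r := fun x hx =>
    Metric.ball_subset_ball (half_le_self hr.le) (hVsub hx).2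
  refine ⟨V, fun x hx => (hball x (hVball hx)).2, hV, hpV, 2 * C₁ * ‖v‖, by positivity,
    fun x hx => ?_⟩
  have hxU : x ∈ U := (hball x (hVball hx.2)).2
  have hρx : ρ x < 0 := (hmem x hxU).1 hx.1
  set γ : ℝ → E n := fun t => x + t • v with hγ
  set T : ℝ := -2 * ρ x with hT
  have hT0 : 0 < T := by rw [hT]; linarith
  have hγball : ∀ t ∈ Icc 0 T, γ t ∈ Metric.ball p r := fun t ht => by
    have h1 : dist (γ t) x = t * ‖v‖ := by
      simp [hγ, dist_eq_norm, norm_smul, abs_of_nonneg ht.1]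
    have h2 : t * ‖v‖ ≤ T * ‖v‖ := mul_le_mul_of_nonneg_right ht.2 (norm_nonneg _)
    have h3 : T * ‖v‖ < r / 2 := (hVsub hx.2).1
    have h4 : dist x p < r / 2 := (hVsub hx.2).2
    have := dist_triangle (γ t) x p
    rw [Metric.mem_ball]
    linarith
  have hγd : ∀ t, HasDerivAt γ v t := fun t => by
    simpa [hγ] using ((hasDerivAt_id t).smul_const v).const_add x
  have hγc : Continuous γ := by fun_prop
  set h : ℝ → ℝ := fun t => ρ (γ t) with hh
  have hhd : ∀ t ∈ Icc 0 T, HasDerivAt h (fderiv ℝ ρ (γ t) v) t := fun t ht =>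
    (hρd _ (hball _ (hγball t ht)).2).hasFDerivAt.comp_hasDerivAt t (hγd t)
  have hhc : ContinuousOn h (Icc 0 T) := fun t ht => (hhd t ht).continuousAt.continuousWithinAt
  have hslope : ∀ s ∈ Icc 0 T, ∀ t ∈ Icc 0 T, s < t → h s + (t - s) / 2 < h t :=
    fun s hs t ht hst => by
      have hsub : Icc s t ⊆ Icc 0 T := Icc_subset_Icc hs.1 ht.2
      obtain ⟨c, hc, hceq⟩ := exists_hasDerivAt_eq_slope h (fun t => fderiv ℝ ρ (γ t) v) hst
        (hhc.mono hsub) fun c hc => hhd c (hsub (Ioo_subset_Icc_self hc))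
      have hlt : 1 / 2 < fderiv ℝ ρ (γ c) v :=
        (hball _ (hγball c (hsub (Ioo_subset_Icc_self hc)))).1.1
      rw [hceq, lt_div_iff₀ (sub_pos.2 hst)] at hlt
      linarith
  have hh0 : h 0 = ρ x := by simp [hh, hγ]
  have hhT : 0 ≤ h T := by
    have := hslope 0 ⟨le_rfl, hT0.le⟩ T ⟨hT0.le, le_rfl⟩ hT0
    rw [hh0, hT] at this
    rw [hT]
    linarith
  obtain ⟨t₀, ht₀, hht₀⟩ := intermediate_value_Icc hT0.le hhc
    (show (0 : ℝ) ∈ Icc (h 0) (h T) from ⟨by rw [hh0]; exact hρx.le, hhT⟩)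
  have ht₀pos : 0 < t₀ := by
    refine lt_of_le_of_ne ht₀.1 fun hc => ?_
    rw [← hc, hh0] at hht₀
    exact hρx.ne hht₀
  have hsub₀ : Icc 0 t₀ ⊆ Icc 0 T := Icc_subset_Icc le_rfl ht₀.2
  have hγΩ : ∀ t ∈ Ico 0 t₀, γ t ∈ Ω := fun t ht => by
    have htT := hsub₀ (Ico_subset_Icc_self ht)
    refine (hmem _ (hball _ (hγball t htT)).2).2 ?_
    have := hslope t htT t₀ ht₀ ht.2
    rw [hht₀] at this
    have h2 := ht.2
    change h t < 0
    linarith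
  have hγcl : ∀ t ∈ Icc 0 t₀, γ t ∈ closure Ω := fun t ht => by
    have hcl : closure (Ico 0 t₀) = Icc 0 t₀ := closure_Ico ht₀pos.ne
    rw [← hcl] at ht
    exact map_mem_closure hγc ht hγΩ
  have hq : γ t₀ ∈ frontier Ω := by
    rw [hΩ.frontier_eq]
    refine ⟨hγcl t₀ ⟨ht₀pos.le, le_rfl⟩, fun hc => ?_⟩
    have := (hmem _ (hball _ (hγball t₀ ht₀)).2).1 hc
    exact this.ne hht₀
  have hgt₀ : g (γ t₀) = 0 := hg0 _ hq (hball _ (hγball t₀ ht₀)).2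
  have hγS : ∀ t ∈ Icc 0 t₀, γ t ∈ S := fun t ht =>
    ⟨hγcl t ht, (hball _ (hγball t (hsub₀ ht))).2⟩
  have hkc : ContinuousOn (fun t => g (γ t)) (Icc 0 t₀) :=
    hgS.continuousOn.comp hγc.continuousOn hγS
  have hkd : ∀ t ∈ Ioo 0 t₀, HasDerivAt (fun t => g (γ t)) (fderivWithin ℝ g S (γ t) v) t :=
    fun t ht => by
      have hnhds : S ∈ 𝓝 (γ t) := by
        refine mem_of_superset ((hΩ.inter hU).mem_nhds ⟨hγΩ t (Ioo_subset_Ico_self ht),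
          (hγS t (Ioo_subset_Icc_self ht)).2⟩) ?_
        exact inter_subset_inter_left _ subset_closure
      have h1 : HasFDerivAt g (fderivWithin ℝ g S (γ t)) (γ t) :=
        ((hgS.differentiableOn one_ne_zero _ (hγS t (Ioo_subset_Icc_self ht))).hasFDerivWithinAt
          ).hasFDerivAt hnhds
      exact h1.comp_hasDerivAt t (hγd t)
  -- The mean value theorem along the segment to the boundary point γ(t₀), where g vanishes: g(x) is
  -- bounded by a constant times t₀ ≤ T = -2ρ(x).
  obtain ⟨c, hc, hceq⟩ := exists_hasDerivAt_eq_slope _ _ ht₀pos hkc hkd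
  have hγ0 : γ 0 = x := by simp [hγ]
  simp only [hgt₀, hγ0, sub_zero, zero_sub] at hceq
  have hgx : g x = -(fderivWithin ℝ g S (γ c) v * t₀) := by
    rw [hceq]; field_simp
  have hcI := Ioo_subset_Icc_self hc
  have hder : |fderivWithin ℝ g S (γ c) v| ≤ C₁ * ‖v‖ :=
    ((fderivWithin ℝ g S (γ c)).le_opNorm v).trans (mul_le_mul_of_nonneg_right
      ((hball _ (hγball c (hsub₀ hcI))).1.2 (hγS c hcI)).le (norm_nonneg _))
  change |g x| ≤ _
  rw [hgx, abs_neg, abs_mul, abs_of_pos ht₀pos]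
  calc |fderivWithin ℝ g S (γ c) v| * t₀ ≤ (C₁ * ‖v‖) * T :=
        mul_le_mul hder ht₀.2 ht₀pos.le (by positivity)
    _ = 2 * C₁ * ‖v‖ * -ρ x := by rw [hT]; ring

/-- At interior points there is no boundary to avoid, so a constant d serves. -/
theorem vanishingFluxAt_of_mem {n : ℕ} {Ω : Set (E n)} (hΩ : IsOpen Ω) (F : E n → E n) {p : E n}
    (hp : p ∈ Ω) : VanishingFluxAt Ω F p := by
  refine ⟨Ω, fun _ => 1, hΩ, hp, contDiffOn_const, fun _ _ => one_pos, fun K hK hKc ε _ => ?_,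
    fun K _ _ => ⟨0, fun x _ _ => by simp⟩⟩
  by_cases hε : ε ≤ 1
  · convert hKc using 1
    ext x
    exact ⟨fun h => h.1, fun h => ⟨h, hK h, hε⟩⟩
  · convert isCompact_empty (X := E n) using 1
    ext x
    exact ⟨fun h => hε h.2.2, fun h => h.elim⟩

theorem vanishingFluxAt_of_notMem_closure {n : ℕ} {Ω : Set (E n)} (F : E n → E n) {p : E n}
    (hp : p ∉ closure Ω) : VanishingFluxAt Ω F p := by
  refine ⟨(closure Ω)ᶜ, fun _ => 1, isClosed_closure.isOpen_compl, hp, contDiffOn_const,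
    fun _ _ => one_pos, fun K hK _ ε _ => ?_, fun K _ _ => ⟨0, fun x _ _ => by simp⟩⟩
  convert isCompact_empty (X := E n) using 1
  ext x
  exact ⟨fun h => hK h.1 (subset_closure h.2.1), fun h => h.elim⟩

/-- A bounded multiple of a `C¹` field that is tangent to `∂Ω` has zero flux through `∂Ω`. -/
theorem vanishingFluxAt_of_tangent {n : ℕ} (hn : 1 ≤ n) {α : ℝ≥0} {Ω : Set (E n)}
    (hΩ : IsOpen Ω) (hreg : HasRegularBoundary α Ω) {G : E n → E n}
    (hG : ContDiffOn ℝ 1 G (closure Ω))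
    (hGν : ∀ q ∈ frontier Ω, inner ℝ (outerNormal Ω q) (G q) = 0) {w : E n → ℝ} {W : ℝ}
    (hw : ∀ x ∈ Ω, |w x| ≤ W) {p : E n} (hp : p ∈ frontier Ω) :
    VanishingFluxAt Ω (fun x => w x • G x) p := by
  obtain ⟨U, ρ, hU, hpU, hρ, h0, hΩU⟩ := hreg.exists_definingFunction hn hΩ hp
  obtain ⟨V, hVU, hV, hpV, C, hC, hVC⟩ := exists_abs_fderiv_definingFunction_le hΩ
    (hreg.uniqueDiffOn_closure hn hΩ) hp hU hpU hρ h0 hΩU hG hGν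
  have hmem : ∀ x ∈ U, (x ∈ Ω ↔ ρ x < 0) := fun x hx => by
    have := Set.ext_iff.1 hΩU x
    simpa [hx] using this
  refine ⟨V, fun x => -ρ x, hV, hpV, ?_, fun x hx => ?_, fun K hK hKc ε hε => ?_,
    fun K hK _ => ⟨W * C, fun x hx hxK => ?_⟩⟩
  · exact ((hρ.of_le one_le_two).mono (inter_subset_right.trans hVU)).neg
  · exact neg_pos.2 ((hmem x (hVU hx.2)).1 hx.1)
  · have hcl : IsClosed (K ∩ ρ ⁻¹' Iic (-ε)) :=
      (hρ.continuousOn.mono (hK.trans hVU)).preimage_isClosed_of_isClosed hKc.isClosed isClosed_Iic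
    convert hKc.of_isClosed_subset hcl inter_subset_left using 1
    ext x
    constructor
    · rintro ⟨h1, -, h3⟩
      exact ⟨h1, by simp only [mem_preimage, mem_Iic]; linarith⟩
    · rintro ⟨h1, h2⟩
      simp only [mem_preimage, mem_Iic] at h2
      exact ⟨h1, (hmem x (hVU (hK h1))).2 (by linarith), by linarith⟩
  · have h1 := hVC x ⟨hx, hK hxK⟩
    have h2 := hw x hx
    rw [fderiv_fun_neg, neg_apply, abs_neg, map_smul, smul_eq_mul, abs_mul, mul_assoc]
    exact mul_le_mul h2 h1 (abs_nonneg _) ((abs_nonneg _).trans h2)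

/-! ### The quadratic form of the coefficient matrix -/

section Matrix

variable {n : ℕ} {M : Matrix (Fin n) (Fin n) ℝ}

theorem matVec_add (M : Matrix (Fin n) (Fin n) ℝ) (u v : E n) :
    matVec M (u + v) = matVec M u + matVec M v := by
  ext i; simp [matVec, Matrix.mulVec_add]

theorem matVec_sub (M : Matrix (Fin n) (Fin n) ℝ) (u v : E n) :
    matVec M (u - v) = matVec M u - matVec M v := by
  ext i; simp [matVec, Matrix.mulVec_sub]

theorem matVec_smul (M : Matrix (Fin n) (Fin n) ℝ) (t : ℝ) (v : E n) :
    matVec M (t • v) = t • matVec M v := by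
  ext i; simp [matVec, Matrix.mulVec_smul]

theorem inner_matVec (M : Matrix (Fin n) (Fin n) ℝ) (u v : E n) :
    inner ℝ u (matVec M v) = u.ofLp ⬝ᵥ M *ᵥ v.ofLp := by
  rw [EuclideanSpace.inner_eq_star_dotProduct, dotProduct_comm]
  simp [matVec]

theorem inner_matVec_comm (hM : M.IsHermitian) (u v : E n) :
    inner ℝ (matVec M u) v = inner ℝ u (matVec M v) := by
  have hT : Mᵀ = M := by simpa [Matrix.IsHermitian] using hM
  rw [real_inner_comm, inner_matVec, inner_matVec, Matrix.dotProduct_mulVec, dotProduct_comm,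
    ← Matrix.mulVec_transpose, hT]

theorem inner_matVec_pos (hM : M.PosDef) {v : E n} (hv : v ≠ 0) : 0 < inner ℝ v (matVec M v) := by
  rw [inner_matVec]
  simpa using hM.dotProduct_mulVec_pos (x := v.ofLp) (by simpa using hv)

theorem inner_matVec_nonneg (hM : M.PosDef) (v : E n) : 0 ≤ inner ℝ v (matVec M v) := by
  by_cases hv : v = 0
  · simp [hv]
  · exact (inner_matVec_pos hM hv).le

/-- Cauchy–Schwarz for the form of M, from the discriminant of t ↦ (a + tb)·M(a + tb) ≥ 0. It
replaces any uniform ellipticity. -/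
theorem inner_matVec_sq_le (hM : M.PosDef) (a b : E n) :
    inner ℝ b (matVec M a) ^ 2 ≤ inner ℝ a (matVec M a) * inner ℝ b (matVec M b) := by
  have hab : inner ℝ a (matVec M b) = inner ℝ b (matVec M a) := by
    rw [← inner_matVec_comm hM.1, real_inner_comm]
  have h := discrim_le_zero (a := inner ℝ b (matVec M b)) (b := 2 * inner ℝ b (matVec M a))
    (c := inner ℝ a (matVec M a)) fun t => by
      have := inner_matVec_nonneg hM (a + t • b)
      rw [matVec_add, matVec_smul, inner_add_left, inner_add_right, inner_add_right,
        real_inner_smul_left, real_inner_smul_left, real_inner_smul_right, real_inner_smul_right,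
        hab] at this
      linarith
  rw [discrim] at h
  linarith

theorem matVec_matVec_inv (hM : M.PosDef) (v : E n) : matVec M (matVec M⁻¹ v) = v := by
  have hdet : IsUnit M.det := (Matrix.isUnit_iff_isUnit_det _).1 hM.isUnit
  ext i
  simp [matVec, Matrix.mulVec_mulVec, Matrix.mul_nonsing_inv _ hdet]

theorem abs_inner_matVec_le {m : ℝ} (hm : ∀ i j, |M i j| ≤ m) (b : E n) :
    |inner ℝ b (matVec M b)| ≤ n * (n * m) * ‖b‖ ^ 2 := by
  have hb : ∀ i, |b i| ≤ ‖b‖ := fun i => PiLp.norm_apply_le b i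
  rw [inner_matVec]
  simp only [dotProduct, Matrix.mulVec, Finset.mul_sum]
  calc |∑ i, ∑ j, b i * (M i j * b j)| ≤ ∑ i, ∑ j, |b i * (M i j * b j)| :=
        (Finset.abs_sum_le_sum_abs _ _).trans
          (Finset.sum_le_sum fun i _ => Finset.abs_sum_le_sum_abs _ _)
    _ ≤ ∑ _i : Fin n, ∑ _j : Fin n, ‖b‖ * (m * ‖b‖) := by
        refine Finset.sum_le_sum fun i _ => Finset.sum_le_sum fun j _ => ?_
        rw [abs_mul, abs_mul]
        have h1 := hb i
        have h2 := hb j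
        have h3 := hm i j
        have h4 := (abs_nonneg _).trans h3
        gcongr
    _ = n * (n * m) * ‖b‖ ^ 2 := by
        simp only [Finset.sum_const, Finset.card_univ, Fintype.card_fin, nsmul_eq_mul]
        ring

end Matrix

/-! ### Conormal fields and the weighted Wronskian -/

/-- The field `A∇u`, up to the boundary. -/
def conormal {n : ℕ} (L : Coefficients n) (Ω : Set (E n)) (u : E n → ℝ) (x : E n) : E n :=
  matVec (L.A x) (gradientWithin u (closure Ω) x)

section Conormal

variable {n : ℕ} {Ω : Set (E n)} {L : Coefficients n} {u : E n → ℝ}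

theorem contDiffOn_gradientWithin {S : Set (E n)} (hS : UniqueDiffOn ℝ S)
    (hu : ContDiffOn ℝ 2 u S) : ContDiffOn ℝ 1 (gradientWithin u S) S :=
  (InnerProductSpace.toDual ℝ (E n)).symm.contDiff.comp_contDiffOn
    (hu.fderivWithin hS (by norm_num))

theorem contDiffOn_conormal (hud : UniqueDiffOn ℝ (closure Ω))
    (hA : ∀ i j, ContDiffOn ℝ 1 (fun x => L.A x i j) (closure Ω))
    (hu : ContDiffOn ℝ 2 u (closure Ω)) : ContDiffOn ℝ 1 (conormal L Ω u) (closure Ω) := by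
  have hg := contDiffOn_euclidean.1 (contDiffOn_gradientWithin hud hu)
  refine contDiffOn_euclidean.2 fun i => ?_
  simp only [conormal, matVec, Matrix.mulVec, dotProduct]
  exact ContDiffOn.sum fun j _ => (hA i j).mul (hg j)

theorem gradientWithin_closure_eq (hΩ : IsOpen Ω) {x : E n} (hx : x ∈ Ω) :
    gradientWithin u (closure Ω) x = gradient u x := by
  rw [gradientWithin, gradient,
    fderivWithin_of_mem_nhds (mem_of_superset (hΩ.mem_nhds hx) subset_closure)]

theorem conormal_eq (hΩ : IsOpen Ω) {x : E n} (hx : x ∈ Ω) :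
    conormal L Ω u x = matVec (L.A x) (gradient u x) := by
  rw [conormal, gradientWithin_closure_eq hΩ hx]

theorem divergence_conormal (hΩ : IsOpen Ω) {x : E n} (hx : x ∈ Ω) {l : ℝ}
    (hl : L.op u x = l * u x) : divergence (conormal L Ω u) x
      = -(inner ℝ (L.B x) (gradient u x) + L.c x * u x + l * u x) := by
  have h : divergence (conormal L Ω u) x
      = divergence (fun y => matVec (L.A y) (gradient u y)) x := by
    refine divergence_eq_of_eventuallyEq ?_
    filter_upwards [hΩ.mem_nhds hx] with y hy using conormal_eq hΩ hy
  rw [h, ← hl, Coefficients.op]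
  ring

end Conormal

section Wronskian

variable {n : ℕ} {Ω : Set (E n)} {L : Coefficients n} {φ ψ η : E n → ℝ}

/-- The field `ψ A∇φ - φ A∇ψ`. -/
def wronskian (L : Coefficients n) (Ω : Set (E n)) (φ ψ : E n → ℝ) (x : E n) : E n :=
  ψ x • conormal L Ω φ x - φ x • conormal L Ω ψ x

theorem contDiffOn_wronskian (hud : UniqueDiffOn ℝ (closure Ω))
    (hA : ∀ i j, ContDiffOn ℝ 1 (fun x => L.A x i j) (closure Ω))
    (hφ : ContDiffOn ℝ 2 φ (closure Ω)) (hψ : ContDiffOn ℝ 2 ψ (closure Ω)) :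
    ContDiffOn ℝ 1 (wronskian L Ω φ ψ) (closure Ω) :=
  ((hψ.of_le one_le_two).smul (contDiffOn_conormal hud hA hφ)).sub
    ((hφ.of_le one_le_two).smul (contDiffOn_conormal hud hA hψ))

theorem wronskian_eq (hΩ : IsOpen Ω) {x : E n} (hx : x ∈ Ω) :
    wronskian L Ω φ ψ x = matVec (L.A x) (ψ x • gradient φ x - φ x • gradient ψ x) := by
  rw [wronskian, conormal_eq hΩ hx, conormal_eq hΩ hx, matVec_sub, matVec_smul, matVec_smul]

/-- The terms γφψ cancel, whatever the sign of γ. -/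
theorem inner_outerNormal_wronskian {γ : E n → ℝ} {x : E n}
    (hφ : (BoundaryCondition.robin γ).op Ω L φ x = 0)
    (hψ : (BoundaryCondition.robin γ).op Ω L ψ x = 0) :
    inner ℝ (outerNormal Ω x) (wronskian L Ω φ ψ x) = 0 := by
  have h1 : inner ℝ (outerNormal Ω x) (conormal L Ω φ x) + γ x * φ x = 0 := hφ
  have h2 : inner ℝ (outerNormal Ω x) (conormal L Ω ψ x) + γ x * ψ x = 0 := hψ
  rw [wronskian, inner_sub_right, real_inner_smul_right, real_inner_smul_right]
  linear_combination ψ x * h1 - φ x * h2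

/-- In the self-adjoint form of the operator, the weighted Wronskian of two eigenfunctions is
solenoidal. -/
theorem divergence_exp_smul_wronskian (hΩ : IsOpen Ω) (hud : UniqueDiffOn ℝ (closure Ω))
    (hA : ∀ i j, ContDiffOn ℝ 1 (fun x => L.A x i j) (closure Ω))
    (hφ : ContDiffOn ℝ 2 φ (closure Ω)) (hψ : ContDiffOn ℝ 2 ψ (closure Ω)) {x : E n} (hx : x ∈ Ω)
    (hpd : (L.A x).PosDef) (hη : DifferentiableAt ℝ η x)
    (hgη : gradient η x = -matVec (L.A x)⁻¹ (L.B x)) {l : ℝ}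
    (hlφ : L.op φ x = l * φ x) (hlψ : L.op ψ x = l * ψ x) :
    divergence (fun y => Real.exp (-η y) • wronskian L Ω φ ψ y) x = 0 := by
  have hnh : closure Ω ∈ 𝓝 x := mem_of_superset (hΩ.mem_nhds hx) subset_closure
  have hd : ∀ {u : E n → ℝ}, ContDiffOn ℝ 2 u (closure Ω) → DifferentiableAt ℝ u x :=
    fun hu => (hu.contDiffAt hnh).differentiableAt two_ne_zero
  have hdc : ∀ {u : E n → ℝ}, ContDiffOn ℝ 2 u (closure Ω) →
      DifferentiableAt ℝ (conormal L Ω u) x := fun hu =>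
    ((contDiffOn_conormal hud hA hu).contDiffAt hnh).differentiableAt one_ne_zero
  have hw : HasFDerivAt (fun y => Real.exp (-η y)) (Real.exp (-η x) • -fderiv ℝ η x) x :=
    hη.hasFDerivAt.neg.exp
  -- Differentiating the weight e^{-η} thus produces +B·∇u, which cancels the drift term in the
  -- divergence of A∇u.
  have hBη : ∀ u : E n → ℝ, fderiv ℝ η x (conormal L Ω u x) = -inner ℝ (L.B x) (gradient u x) :=
    fun u => by
      rw [fderiv_apply_eq_inner_gradient, hgη, conormal_eq hΩ hx, inner_neg_left,
        ← inner_matVec_comm hpd.1, matVec_matVec_inv hpd]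
  have hsplit : (fun y => Real.exp (-η y) • wronskian L Ω φ ψ y)
      = fun y => (Real.exp (-η y) * ψ y) • conormal L Ω φ y
        - (Real.exp (-η y) * φ y) • conormal L Ω ψ y := by
    funext y
    rw [wronskian, smul_sub, smul_smul, smul_smul]
  -- Symmetry of A makes the right-hand side symmetric in u and v, so the two halves of the
  -- Wronskian cancel.
  have hterm : ∀ {u v : E n → ℝ}, ContDiffOn ℝ 2 u (closure Ω) → ContDiffOn ℝ 2 v (closure Ω) →
      L.op u x = l * u x →
      divergence (fun y => (Real.exp (-η y) * v y) • conormal L Ω u y) x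
        = Real.exp (-η x) * (inner ℝ (gradient v x) (matVec (L.A x) (gradient u x))
          - (L.c x + l) * (u x * v x)) := fun {u v} hu hv hlu => by
    have h1 := hw.fun_mul (hd hv).hasFDerivAt
    rw [divergence_smul h1.differentiableAt (hdc hu), divergence_conormal hΩ hx hlu, h1.fderiv]
    simp only [add_apply, smul_apply, neg_apply, smul_eq_mul, hBη]
    rw [fderiv_apply_eq_inner_gradient, conormal_eq hΩ hx]
    ring
  rw [hsplit, divergence_sub ((hw.differentiableAt.fun_mul (hd hψ)).fun_smul (hdc hφ))
    ((hw.differentiableAt.fun_mul (hd hφ)).fun_smul (hdc hψ)), hterm hφ hψ hlφ, hterm hψ hφ hlψ,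
    ← inner_matVec_comm hpd.1, real_inner_comm]
  ring

/-- Under the Dirichlet condition, the weighted Wronskian has zero flux through the boundary. -/
theorem vanishingFluxAt_of_dirichlet (hΩ : IsOpen Ω) (hud : UniqueDiffOn ℝ (closure Ω))
    (hA : ∀ i j, ContDiffOn ℝ 1 (fun x => L.A x i j) (closure Ω))
    (hφ : ContDiffOn ℝ 2 φ (closure Ω)) (hψ : ContDiffOn ℝ 2 ψ (closure Ω))
    (hφ0 : ∀ x ∈ Ω, 0 < φ x) (hψ0 : ∀ x ∈ Ω, 0 < ψ x)
    (hφb : ∀ x ∈ frontier Ω, φ x = 0) (hψb : ∀ x ∈ frontier Ω, ψ x = 0) {w : E n → ℝ} {W : ℝ}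
    (hw : ∀ x ∈ Ω, |w x| ≤ W) (p : E n) :
    VanishingFluxAt Ω (fun x => w x • wronskian L Ω φ ψ x) p := by
  have hd : ContDiffOn ℝ 1 (fun x => φ x + ψ x) (closure Ω) :=
    (hφ.of_le one_le_two).add (hψ.of_le one_le_two)
  -- The choice d = φ + ψ is positive in Ω and zero on ∂Ω. The required bound is immediate because φ
  -- and ψ are themselves the coefficients in the Wronskian.
  refine ⟨univ, fun x => φ x + ψ x, isOpen_univ, mem_univ _,
    hd.mono (inter_subset_left.trans subset_closure),
    fun x hx => add_pos (hφ0 x hx.1) (hψ0 x hx.1), fun K _ hK ε hε => ?_, fun K _ hK => ?_⟩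
  · have hKc : IsCompact (K ∩ closure Ω) := hK.inter_right isClosed_closure
    have hcl : IsClosed ((K ∩ closure Ω) ∩ (fun x => φ x + ψ x) ⁻¹' Ici ε) :=
      (hd.continuousOn.mono inter_subset_right).preimage_isClosed_of_isClosed hKc.isClosed
        isClosed_Ici
    convert hKc.of_isClosed_subset hcl inter_subset_left using 1
    ext x
    constructor
    · rintro ⟨h1, h2, h3⟩
      exact ⟨⟨h1, subset_closure h2⟩, h3⟩
    · rintro ⟨⟨h1, h2⟩, h3⟩
      refine ⟨h1, ?_, h3⟩
      by_contra hx
      have hxf : x ∈ frontier Ω := by rw [hΩ.frontier_eq]; exact ⟨h2, hx⟩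
      simp only [mem_preimage, mem_Ici, hφb x hxf, hψb x hxf] at h3
      linarith
  · have hKc : IsCompact (K ∩ closure Ω) := hK.inter_right isClosed_closure
    have hder := hd.continuousOn_fderivWithin hud le_rfl
    have hbound : ∀ {u : E n → ℝ}, ContDiffOn ℝ 2 u (closure Ω) → ∃ C, ∀ x ∈ K ∩ closure Ω,
        |fderivWithin ℝ (fun x => φ x + ψ x) (closure Ω) x (conormal L Ω u x)| ≤ C := fun hu =>
      hKc.exists_bound_of_continuousOn ((hder.clm_apply
        (contDiffOn_conormal hud hA hu).continuousOn).mono inter_subset_right)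
    obtain ⟨C₁, hC₁⟩ := hbound hφ
    obtain ⟨C₂, hC₂⟩ := hbound hψ
    refine ⟨W * max C₁ C₂, fun x hx hxK => ?_⟩
    have h1 := hC₁ x ⟨hxK, subset_closure hx⟩
    have h2 := hC₂ x ⟨hxK, subset_closure hx⟩
    rw [fderivWithin_of_mem_nhds (mem_of_superset (hΩ.mem_nhds hx) subset_closure)] at h1 h2
    have hφx := hφ0 x hx
    have hψx := hψ0 x hx
    rw [map_smul, wronskian, map_sub, map_smul, map_smul, smul_eq_mul, smul_eq_mul, smul_eq_mul,
      abs_mul, mul_assoc]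
    refine mul_le_mul (hw x hx) ?_ (abs_nonneg _) ((abs_nonneg _).trans (hw x hx))
    refine (abs_sub _ _).trans ?_
    rw [abs_mul, abs_mul, abs_of_pos hφx, abs_of_pos hψx]
    calc ψ x * |fderiv ℝ (fun x => φ x + ψ x) x (conormal L Ω φ x)|
          + φ x * |fderiv ℝ (fun x => φ x + ψ x) x (conormal L Ω ψ x)|
        ≤ ψ x * max C₁ C₂ + φ x * max C₁ C₂ := by
          gcongr
          · exact h1.trans (le_max_left _ _)
          · exact h2.trans (le_max_right _ _)
      _ = max C₁ C₂ * (φ x + ψ x) := by ring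

end Wronskian

/-! ### Rigidity of the quotient and simplicity -/

theorem fderiv_div_add_apply {n : ℕ} {φ ψ : E n → ℝ} {x : E n}
    (hφ : DifferentiableAt ℝ φ x) (hψ : DifferentiableAt ℝ ψ x) (h0 : φ x + ψ x ≠ 0) (v : E n) :
    fderiv ℝ (fun y => φ y / (φ y + ψ y)) x v
      = inner ℝ (ψ x • gradient φ x - φ x • gradient ψ x) v / (φ x + ψ x) ^ 2 := by
  have hs := hφ.hasFDerivAt.fun_add hψ.hasFDerivAt
  have h : HasFDerivAt (fun y => φ y * (φ y + ψ y)⁻¹) _ x :=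
    hφ.hasFDerivAt.fun_mul ((hasDerivAt_inv h0).comp_hasFDerivAt x hs)
  simp only [div_eq_mul_inv]
  rw [h.fderiv]
  simp only [smul_apply, add_apply, smul_eq_mul,
    fderiv_apply_eq_inner_gradient, inner_sub_left, real_inner_smul_left]
  field_simp
  ring

theorem StandingAssumptions.isBoundedOn_matrix {n : ℕ} {α : ℝ≥0} {Ω : Set (E n)}
    {L : Coefficients n} {b : BoundaryCondition n} (hH : StandingAssumptions α Ω L b) :
    ∃ m, 0 ≤ m ∧ ∀ x ∈ Ω, ∀ i j, |L.A x i j| ≤ m := by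
  choose M hM using hH.bounded_A
  refine ⟨∑ i, ∑ j, |M i j|, by positivity, fun x hx i j => ?_⟩
  calc |L.A x i j| ≤ |M i j| := (hM i j x (subset_closure hx)).trans (le_abs_self _)
    _ ≤ ∑ j, |M i j| :=
        Finset.single_le_sum (f := fun j => |M i j|) (fun _ _ => abs_nonneg _) (Finset.mem_univ j)
    _ ≤ ∑ i, ∑ j, |M i j| :=
        Finset.single_le_sum (f := fun i => ∑ j, |M i j|)
          (fun _ _ => Finset.sum_nonneg fun _ _ => abs_nonneg _) (Finset.mem_univ i)

/-- A positive eigenfunction is proportional to any bounded one, inside the domain. -/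
theorem exists_eq_mul_of_bounded {n : ℕ} (hn : 1 ≤ n) {α : ℝ≥0} {Ω : Set (E n)}
    {L : Coefficients n} {b : BoundaryCondition n} (hH : StandingAssumptions α Ω L b)
    (hdrift : BoundedPotentialDrift Ω L) (hgrowth : QuadraticGrowth Ω) {φ ψ : E n → ℝ}
    (hφ : IsPrincipalEigenfunction α Ω L b φ) (hφb : BoundedOn Ω φ)
    (hψ : IsPrincipalEigenfunction α Ω L b ψ) :
    ∃ t : ℝ, 0 < t ∧ ∀ x ∈ Ω, ψ x = t * φ x := by
  have hΩ := hH.isOpen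
  have hud := hH.regularBoundary.uniqueDiffOn_closure hn hΩ
  obtain ⟨η, hη1, ⟨N, hN⟩, hgη⟩ := hdrift
  obtain ⟨P, hP⟩ := hφb
  obtain ⟨m, hm0, hm⟩ := hH.isBoundedOn_matrix
  obtain ⟨l, hl, hlφ⟩ := hφ.interior
  obtain ⟨l', hl', hlψ⟩ := hψ.interior
  have hll : l' = l := EReal.coe_injective (hl'.symm.trans hl)
  rw [hll] at hlψ
  have hA : ∀ i j, ContDiffOn ℝ 1 (fun x => L.A x i j) (closure Ω) := fun i j =>
    (hH.holder_A i j).1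
  have hφ2 : ContDiffOn ℝ 2 φ (closure Ω) := hφ.regular.1
  have hψ2 : ContDiffOn ℝ 2 ψ (closure Ω) := hψ.regular.1
  have hdiff : ∀ {u : E n → ℝ}, ContDiffOn ℝ 2 u (closure Ω) → ∀ x ∈ Ω, DifferentiableAt ℝ u x :=
    fun hu x hx => (hu.contDiffAt (mem_of_superset (hΩ.mem_nhds hx) subset_closure)
      ).differentiableAt two_ne_zero
  set w : E n → ℝ := fun x => Real.exp (-η x) with hw
  have hw0 : ∀ x, 0 < w x := fun x => Real.exp_pos _
  have hwW : ∀ x ∈ Ω, w x ≤ Real.exp N := fun x hx =>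
    Real.exp_le_exp.2 ((neg_le_abs _).trans (hN x hx))
  have hwW' : ∀ x ∈ Ω, |w x| ≤ Real.exp N := fun x hx => by
    rw [abs_of_pos (hw0 x)]; exact hwW x hx
  set G := wronskian L Ω φ ψ with hG
  have hGd : ContDiffOn ℝ 1 G (closure Ω) := contDiffOn_wronskian hud hA hφ2 hψ2
  set F : E n → E n := fun x => w x • G x with hF
  have hFd : ContDiffOn ℝ 1 F Ω := (Real.contDiff_exp.comp_contDiffOn hη1.neg).smul
    (hGd.mono subset_closure)
  have hdiv : ∀ x ∈ Ω, divergence F x = 0 := fun x hx =>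
    divergence_exp_smul_wronskian hΩ hud hA hφ2 hψ2 hx (hH.elliptic x hx)
      ((hη1.contDiffAt (hΩ.mem_nhds hx)).differentiableAt one_ne_zero) (hgη x hx)
      (hlφ x hx) (hlψ x hx)
  have hFb : ∀ K, IsCompact K → ∃ C, ∀ x ∈ Ω, x ∈ K → ‖F x‖ ≤ C := fun K hK => by
    obtain ⟨C, hC⟩ := (hK.inter_right isClosed_closure).exists_bound_of_continuousOn
      (hGd.continuousOn.mono inter_subset_right)
    refine ⟨Real.exp N * C, fun x hx hxK => ?_⟩
    rw [hF, norm_smul]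
    exact mul_le_mul (hwW' x hx) (hC x ⟨hxK, subset_closure hx⟩) (norm_nonneg _)
      (Real.exp_pos _).le
  have hflux : ∀ p, VanishingFluxAt Ω F p := fun p => by
    by_cases hp : p ∈ Ω
    · exact vanishingFluxAt_of_mem hΩ F hp
    by_cases hpc : p ∈ closure Ω
    swap
    · exact vanishingFluxAt_of_notMem_closure F hpc
    have hpf : p ∈ frontier Ω := by rw [hΩ.frontier_eq]; exact ⟨hpc, hp⟩
    have hφB := hφ.boundary
    have hψB := hψ.boundary
    cases b with
    | dirichlet =>
      exact vanishingFluxAt_of_dirichlet hΩ hud hA hφ2 hψ2 hφ.pos hψ.pos hφB hψB hwW' p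
    | robin γ =>
      exact vanishingFluxAt_of_tangent hn hΩ hH.regularBoundary hGd
        (fun q hq => inner_outerNormal_wronskian (hφB q hq) (hψB q hq)) hwW' hpf
  set σ : E n → ℝ := fun x => φ x / (φ x + ψ x) with hσ
  have hsum : ∀ x ∈ Ω, 0 < φ x + ψ x := fun x hx => add_pos (hφ.pos x hx) (hψ.pos x hx)
  have hσd : ContDiffOn ℝ 1 σ Ω :=
    ((hφ2.mono subset_closure).of_le one_le_two).div (((hφ2.mono subset_closure).of_le
      one_le_two).add ((hψ2.mono subset_closure).of_le one_le_two)) fun x hx => (hsum x hx).ne'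
  have hσ1 : ∀ x ∈ Ω, |σ x| ≤ 1 := fun x hx => by
    have h1 := hφ.pos x hx
    have h2 := hψ.pos x hx
    rw [hσ, abs_of_pos (div_pos h1 (hsum x hx)), div_le_one (hsum x hx)]
    linarith
  set a : E n → E n := fun x => ψ x • gradient φ x - φ x • gradient ψ x with ha
  have hFa : ∀ x ∈ Ω, F x = w x • matVec (L.A x) (a x) := fun x hx => by
    simp only [hF, hG, ha, wronskian_eq hΩ hx]
  have hder : ∀ x ∈ Ω, ∀ v, fderiv ℝ σ x v = inner ℝ (a x) v / (φ x + ψ x) ^ 2 :=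
    fun x hx v => fderiv_div_add_apply (hdiff hφ2 x hx) (hdiff hψ2 x hx) (hsum x hx).ne' v
  have hDeq : ∀ x ∈ Ω, fderiv ℝ σ x (F x)
      = w x * inner ℝ (a x) (matVec (L.A x) (a x)) / (φ x + ψ x) ^ 2 := fun x hx => by
    rw [hder x hx, hFa x hx, real_inner_smul_right]
  have hD : ∀ x ∈ Ω, 0 ≤ fderiv ℝ σ x (F x) := fun x hx => by
    rw [hDeq x hx]
    exact div_nonneg (mul_nonneg (hw0 x).le (inner_matVec_nonneg (hH.elliptic x hx) _))
      (sq_nonneg _)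
  -- The numerator φ of σ is the only place where boundedness of an eigenfunction enters. One of the
  -- two factors w is estimated by e^N, and the other stays in F·∇σ.
  have hFσ : ∀ x ∈ Ω, ∀ f : E n →L[ℝ] ℝ, (σ x * f (F x)) ^ 2
      ≤ (P ^ 2 * Real.exp N * (n * (n * m))) * fderiv ℝ σ x (F x) * ‖f‖ ^ 2 := fun x hx f => by
    set b := (InnerProductSpace.toDual ℝ (E n)).symm f with hb
    have hbn : ‖b‖ = ‖f‖ := by simp [hb]
    have hfb : ∀ v, f v = inner ℝ b v := fun v => by simp [hb]
    have hpd := hH.elliptic x hx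
    have h1 := inner_matVec_sq_le hpd (a x) b
    have h2 := (le_abs_self _).trans (abs_inner_matVec_le (hm x hx) b)
    have h3 := inner_matVec_nonneg hpd (a x)
    have h4 : φ x ^ 2 ≤ P ^ 2 := by
      rw [← sq_abs]
      exact pow_le_pow_left₀ (abs_nonneg _) (hP x hx) 2
    rw [hbn] at h2
    have h5 := (hw0 x).le
    have h6 := hwW x hx
    set X := inner ℝ (a x) (matVec (L.A x) (a x)) with hX
    rw [hDeq x hx, hFa x hx, map_smul, smul_eq_mul, hfb, ← hX]
    calc (σ x * (w x * inner ℝ b (matVec (L.A x) (a x)))) ^ 2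
        = φ x ^ 2 * w x * w x * inner ℝ b (matVec (L.A x) (a x)) ^ 2 / (φ x + ψ x) ^ 2 := by
          have := (hsum x hx).ne'
          simp only [hσ]
          field_simp
      _ ≤ P ^ 2 * Real.exp N * w x * (X * (n * (n * m) * ‖f‖ ^ 2)) / (φ x + ψ x) ^ 2 := by
          gcongr
          exact h1.trans (mul_le_mul_of_nonneg_left h2 h3)
      _ = _ := by ring
  have hD0 := fderiv_apply_eq_zero_of_quadraticGrowth hΩ hgrowth hFd hdiv hFb hflux hσd hσ1 hD
    (by positivity) hFσ
  have ha0 : ∀ x ∈ Ω, a x = 0 := fun x hx => by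
    by_contra hne
    have h1 := hD0 x hx
    rw [hDeq x hx] at h1
    exact (div_pos (mul_pos (hw0 x) (inner_matVec_pos (hH.elliptic x hx) hne))
      (pow_pos (hsum x hx) 2)).ne' h1
  -- Since a = 0, the gradient of σ vanishes, and σ equals a constant s on the connected set Ω.
  obtain ⟨s, hs⟩ := hΩ.exists_is_const_of_fderiv_eq_zero (𝕜 := ℝ) hH.isConnected.isPreconnected
    (hσd.differentiableOn one_ne_zero) fun x hx => by
      ext v
      simp [hder x hx, ha0 x hx]
  obtain ⟨x₀, hx₀⟩ := hH.isConnected.nonempty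
  have hφψ : ∀ x ∈ Ω, φ x = s * (φ x + ψ x) := fun x hx => by
    rw [← hs x hx, hσ]
    exact (div_mul_cancel₀ _ (hsum x hx).ne').symm
  have hs0 : 0 < s := by
    rw [← hs x₀ hx₀]
    exact div_pos (hφ.pos x₀ hx₀) (hsum x₀ hx₀)
  have hs1 : s < 1 := by
    rw [← hs x₀ hx₀, hσ, div_lt_one (hsum x₀ hx₀)]
    linarith [hψ.pos x₀ hx₀]
  -- Solving φ = s(φ + ψ) for ψ.
  refine ⟨(1 - s) / s, div_pos (sub_pos.2 hs1) hs0, fun x hx => ?_⟩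
  have := hφψ x hx
  field_simp
  linarith

end EllipticBVP
end

theorem proposition2 {n : ℕ} (hn : 1 ≤ n) (α : NNReal) (hα0 : 0 < α) (hα1 : α < 1)
    (Ω : Set (EllipticBVP.E n)) (L : EllipticBVP.Coefficients n)
    (b : EllipticBVP.BoundaryCondition n)
    (hH : EllipticBVP.StandingAssumptions α Ω L b)
    (hdrift : EllipticBVP.BoundedPotentialDrift Ω L)
    (hgrowth : EllipticBVP.QuadraticGrowth Ω)
    (hbdd : ∃ φ₀ : EllipticBVP.E n → ℝ,
      EllipticBVP.IsPrincipalEigenfunction α Ω L b φ₀ ∧ EllipticBVP.BoundedOn Ω φ₀) :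
    ∀ φ ψ : EllipticBVP.E n → ℝ,
      EllipticBVP.IsPrincipalEigenfunction α Ω L b φ →
      EllipticBVP.IsPrincipalEigenfunction α Ω L b ψ →
      ∃ t : ℝ, ∀ x ∈ closure Ω, ψ x = t * φ x := by
  intro φ ψ hφ hψ
  obtain ⟨φ₀, hφ₀, hb₀⟩ := hbdd
  -- Neither φ nor ψ need be bounded a priori: each is compared with the bounded eigenfunction φ₀,
  -- and the relation then extends to the closure by continuity.
  obtain ⟨s, hs, hφs⟩ :=
    EllipticBVP.exists_eq_mul_of_bounded hn hH hdrift hgrowth hφ₀ hb₀ hφ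
  obtain ⟨t, -, hψt⟩ :=
    EllipticBVP.exists_eq_mul_of_bounded hn hH hdrift hgrowth hφ₀ hb₀ hψ
  refine ⟨t / s, fun x hx => ?_⟩
  have heq : Set.EqOn ψ (fun x => t / s * φ x) Ω := fun y hy => by
    simp only [hφs y hy, hψt y hy]
    field_simp
  exact heq.of_subset_closure hψ.regular.1.continuousOn
    (continuousOn_const.mul hφ.regular.1.continuousOn) subset_closure subset_rfl hx
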